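/- Use units in which the speed of light and the particle rest mass are $1$. Let $\vec u\in\mathbb R^3$ with $|\vec u|<1$, $\theta>0$, $\zeta=1/\theta$. Put $U^0=(1-|\vec u|^2)^{-1/2}$, $U^i=U^0u_i$ ($i=1,2,3$), and for $\vec p\in\mathbb R^3$ put $p^0=\sqrt{1+|\vec p|^2}$, $E=U_\alpha p^\alpha=U^0p^0-\sum_i U^ip^i$ (Minkowski product of signature $(+,-,-,-)$). Let $$g^{(0)}(\vec p)=\frac{\zeta}{4\pi K_2(\zeta)}\,e^{-E/\theta},\qquad K_2(\zeta)=\int_0^\infty \cosh(2\vartheta)\,e^{-\zeta\cosh\vartheta}\,d\vartheta .$$ *Spaces.* Let $\mathbb H$ be the real linear span (finite linear combinations) of all functions $p^{\mu_1}\cdots p^{\mu_n}g^{(0)}$ of $\vec p\in\mathbb R^3$ with $n\ge 0$, $\mu_i\in\{0,1,2,3\}$, and for $M\in\mathbb N=\{0,1,2,\dots\}$ let $\mathbb H_M$ be the span of those with $n\le M$. Put $$\langle f,h\rangle=\int_{\mathbb R^3}\frac{1}{g^{(0)}(\vec p)}\,f(\vec p)\,h(\vec p)\,\frac{d^3\vec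 p}{p^0}.$$ *Polynomials.* For $\ell\in\mathbb N$ let $P_k^{(\ell)}(x;\zeta)$, $k\ge0$, be the orthonormal polynomials ($\deg P^{(\ell)}_k=k$, positive leading coefficient) of the weight $\omega^{(\ell)}(x;\zeta)=\frac{\zeta (x^2-1)^{\ell+1/2}}{(2\ell+1)K_2(\zeta)}e^{-\zeta x}$ on $[1,\infty)$. *Spherical harmonics.* For $0\le m\le\ell$ let $$\check P_\ell^m(y)=\sqrt{\tfrac{(\ell-m)!}{(\ell+m)!}}\,(-1)^m(1-y^2)^{m/2}\frac1{2^\ell\ell!}\frac{d^{\ell+m}}{dy^{\ell+m}}(y^2-1)^\ell ,$$ and let $Y_{\ell,m}(y,\phi)$ be $\sqrt2\,\check P_\ell^{|m|}(y)\sin(|m|\phi)$ for $-\ell\le m<0$, $\check P_\ell^0(y)$ for $m=0$, and $\sqrt2\,\check P_\ell^m(y)\cos(m\phi)$ for $0<m\le\ell$. *Angles.* Let $n_i^0=U^i$, $n_i^j=\frac{U^iU^j}{U^0+1}+\delta_{ij}$ ($i,j=1,2,3$), and for $E>1$ define $y\in[-1,1]$, $\phi\in[0,2\pi)$ by $$(\sqrt{1-y^2}\cos\phi,\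 \sqrt{1-y^2}\sin\phi,\ y)=-(E^2-1)^{-1/2}\,(n_1^\alpha p_\alpha,\ n_2^\alpha p_\alpha,\ n_3^\alpha p_\alpha).$$ Where $y=\pm1$, and at the single point $\vec p=U^0\vec u$ where $E=1$, the functions below do not depend on the undefined coordinates. Define $$\tilde P^{(\ell)}_{k,m}(\vec p)=g^{(0)}(\vec p)\,P_k^{(\ell)}(E;1/\theta)\,(E^2-1)^{\ell/2}\,Y_{\ell,m}(y,\phi).$$ **Statement.** The integral $\langle f,h\rangle$ converges absolutely for all $f,h\in\mathbb H$. The functions $\tilde P^{(\ell)}_{k,m}$ with $k,\ell\in\mathbb N$, $m\in\mathbb Z$, $|m|\le\ell$ form an orthonormal basis of $\mathbb H$, and for every $M\in\mathbb N$ those with $|m|\le\ell\le M$ and $0\le k\le M-\ell$ form an orthonormal basis of $\mathbb H_M$. Here an orthonormal basis is a basis of the vector space in the algebraic sense (every element is a unique finite linear combination) whose members satisfy $\langle \tilde P^{(\ell)}_{k,m},\tilde P^{(\ell')}_{k',m'}\rangle=\delta_{kk'}\delta_{\ell\ell'}\delta_{mm'}$. -/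

import Mathlib

noncomputable section

open Real MeasureTheory Set
open scoped Nat Polynomial

namespace RelMoment

/-! ## Modified Bessel functions and the orthonormal polynomials of one variable -/

/-- The modified Bessel function of the second kind,
`K_ν(ζ) = ∫_0^∞ cosh(ν ϑ) exp(-ζ cosh ϑ) dϑ` (for `ζ > 0`). -/
def besselK (ν ζ : ℝ) : ℝ :=
  ∫ t in Ioi (0 : ℝ), cosh (ν * t) * exp (-ζ * cosh t)

/-- The weight `ω^{(ℓ)}(x; ζ) = ζ (x² - 1)^{ℓ + 1/2} e^{-ζ x} / ((2 ℓ + 1) K_2(ζ))`,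
used for `x > 1`. -/
def weight (ζ : ℝ) (l : ℕ) (x : ℝ) : ℝ :=
  ζ * (x ^ 2 - 1) ^ ((l : ℝ) + 1 / 2) / ((2 * l + 1) * besselK 2 ζ) * exp (-ζ * x)

/-- The inner product `(f, g)_{ω^{(ℓ)}} = ∫_1^∞ f g ω^{(ℓ)} dx` of two polynomials. -/
def weightInner (ζ : ℝ) (l : ℕ) (f g : ℝ[X]) : ℝ :=
  ∫ x in Ioi (1 : ℝ), f.eval x * g.eval x * weight ζ l x

/-- The monic orthogonal polynomials of the weight `ω^{(ℓ)}(·; ζ)`: the Gram-Schmidt process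
applied to `1, x, x², …`. -/
def monicOrthoPoly (ζ : ℝ) (l : ℕ) (k : ℕ) : ℝ[X] :=
  Polynomial.X ^ k - ∑ i : Fin k,
    Polynomial.C (weightInner ζ l (Polynomial.X ^ k) (monicOrthoPoly ζ l i) /
      weightInner ζ l (monicOrthoPoly ζ l i) (monicOrthoPoly ζ l i)) * monicOrthoPoly ζ l i
termination_by k
decreasing_by all_goals exact i.2

/-- `P_k^{(ℓ)}(·; ζ)`: the orthonormal polynomial of degree `k` with positive leading
coefficient of the weight `ω^{(ℓ)}(·; ζ)` on `[1, ∞)`. -/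
def orthoPoly (ζ : ℝ) (l k : ℕ) : ℝ[X] :=
  Polynomial.C (1 / √(weightInner ζ l (monicOrthoPoly ζ l k) (monicOrthoPoly ζ l k))) *
    monicOrthoPoly ζ l k

/-! ## Real spherical harmonics -/

/-- The associated Legendre function
`(-1)^m (1 - y²)^{m/2} (2^ℓ ℓ!)⁻¹ (d/dy)^{ℓ+m} (y² - 1)^ℓ`, for `-1 ≤ y ≤ 1`, `m ≥ 0`. -/
def assocLegendre (l m : ℕ) (y : ℝ) : ℝ :=
  (-1) ^ m * √(1 - y ^ 2) ^ m * (1 / (2 ^ l * (l ! : ℝ))) *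
    (Polynomial.derivative^[l + m] ((Polynomial.X ^ 2 - 1 : ℝ[X]) ^ l)).eval y

/-- The normalised associated Legendre function `√((ℓ-m)!/(ℓ+m)!)` times `assocLegendre`,
for `0 ≤ m ≤ ℓ`. -/
def normLegendre (l m : ℕ) (y : ℝ) : ℝ :=
  √(((l - m)! : ℝ) / ((l + m)! : ℝ)) * assocLegendre l m y

/-- The real spherical harmonic `Y_{ℓ,m}(y, ph)`, for `|m| ≤ ℓ`: sine type for `m < 0`, cosine type for `m > 0`. -/
def sphHarm (l : ℕ) (m : ℤ) (y ph : ℝ) : ℝ :=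
  if m < 0 then √2 * normLegendre l m.natAbs y * sin ((m.natAbs : ℝ) * ph)
  else if m = 0 then normLegendre l 0 y
  else √2 * normLegendre l m.natAbs y * cos ((m.natAbs : ℝ) * ph)

/-! ## Kinematics (units in which the speed of light and the rest mass are `1`) -/

/-- Momenta and velocities: `ℝ³` with the Euclidean norm and Lebesgue measure. -/
abbrev Mom : Type := EuclideanSpace ℝ (Fin 3)

/-- The Minkowski product of signature `(+,-,-,-)` of two contravariant 4-vectors,
`a_α b^α = a⁰ b⁰ - ∑ aⁱ bⁱ`. -/
def mink (a b : Fin 4 → ℝ) : ℝ := a 0 * b 0 - ∑ i : Fin 3, a i.succ * b i.succ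

/-- The particle energy `p⁰ = √(1 + |p|²)`. -/
def p0 (p : Mom) : ℝ := √(1 + ‖p‖ ^ 2)

/-- The 4-momentum `(p^α) = (p⁰, p)`. -/
def fourMom (p : Mom) : Fin 4 → ℝ := Fin.cons (p0 p) (fun i : Fin 3 => p i)

/-- The Lorentz factor `γ(u) = (1 - |u|²)^{-1/2}`. -/
def lorentz (u : Mom) : ℝ := 1 / √(1 - ‖u‖ ^ 2)

/-- The 4-velocity `(U^α) = (γ(u), γ(u) u)`. -/
def fourVel (u : Mom) : Fin 4 → ℝ :=
  Fin.cons (lorentz u) (fun i : Fin 3 => lorentz u * u i)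

/-- `E = U_α p^α`. -/
def energy (u p : Mom) : ℝ := mink (fourVel u) (fourMom p)

/-- The spacelike vectors `n_1, n_2, n_3` of the tetrad:
`n_i⁰ = U^i`, `n_i^j = ((U⁰)² - 1)⁻¹ U^i U^j (U⁰ - 1) + δ_{ij}`. The coefficient
`((U⁰)² - 1)⁻¹ (U⁰ - 1)` is written as `1 / (U⁰ + 1)`, which also covers `u = 0`. -/
def tetrad (u : Mom) (i : Fin 3) : Fin 4 → ℝ :=
  Fin.cons (fourVel u i.succ) (fun j : Fin 3 =>
    fourVel u i.succ * fourVel u j.succ / (fourVel u 0 + 1) + if i = j then 1 else 0)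

/-- The components `-(E² - 1)^{-1/2} n_i^α p_α`, `i = 1, 2, 3`, of the direction of the momentum
in the local rest frame (a unit vector if `E > 1`, that is, if `p ≠ γ(u) u`). -/
def restDir (u p : Mom) (i : Fin 3) : ℝ :=
  -(mink (tetrad u i) (fourMom p)) / √(energy u p ^ 2 - 1)

/-- The coordinate `y = cos ξ`. -/
def yCoord (u p : Mom) : ℝ := restDir u p 2

/-- The azimuth `φ ∈ [0, 2π)`, determined by `√(1-y²) (cos φ, sin φ) = (restDir 0, restDir 1)`. -/
def phiCoord (u p : Mom) : ℝ :=
  toIcoMod Real.two_pi_pos 0 (Complex.arg ⟨restDir u p 0, restDir u p 1⟩)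

/-! ## The weighted polynomial spaces and their basis functions -/

/-- The weight function `g⁽⁰⁾(p) = ζ / (4 π K_2(ζ)) exp(-E/θ)` with `ζ = 1/θ`. -/
def g0 (u : Mom) (θ : ℝ) (p : Mom) : ℝ :=
  θ⁻¹ / (4 * π * besselK 2 θ⁻¹) * exp (-(energy u p / θ))

/-- The function `p^{μ_1} ⋯ p^{μ_n} g⁽⁰⁾`. -/
def weightedMonomial (u : Mom) (θ : ℝ) {n : ℕ} (μ : Fin n → Fin 4) (p : Mom) : ℝ :=
  (∏ j, fourMom p (μ j)) * g0 u θ p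

/-- The space `H`: the (algebraic) span of all `p^{μ_1} ⋯ p^{μ_n} g⁽⁰⁾`. -/
def weightedSpace (u : Mom) (θ : ℝ) : Submodule ℝ (Mom → ℝ) :=
  Submodule.span ℝ {f | ∃ (n : ℕ) (μ : Fin n → Fin 4), f = weightedMonomial u θ μ}

/-- The space `H_M`: the span of all `p^{μ_1} ⋯ p^{μ_n} g⁽⁰⁾` with `n ≤ M`. -/
def weightedSpaceLE (u : Mom) (θ : ℝ) (M : ℕ) : Submodule ℝ (Mom → ℝ) :=
  Submodule.span ℝ {f | ∃ (n : ℕ) (μ : Fin n → Fin 4), n ≤ M ∧ f = weightedMonomial u θ μ}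

/-- The integrand of the inner product, with respect to Lebesgue measure `d³p`. -/
def innerIntegrand (u : Mom) (θ : ℝ) (f h : Mom → ℝ) (p : Mom) : ℝ :=
  1 / g0 u θ p * f p * h p * (1 / p0 p)

/-- The inner product `⟨f, h⟩ = ∫_{ℝ³} (1/g⁽⁰⁾) f h d³p/p⁰`. -/
def spaceInner (u : Mom) (θ : ℝ) (f h : Mom → ℝ) : ℝ :=
  ∫ p : Mom, innerIntegrand u θ f h p

/-- The basis function
`g⁽⁰⁾ P_k^{(ℓ)}(E; 1/θ) (E² - 1)^{ℓ/2} Y_{ℓ,m}(y, φ)`. -/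
def basisFun (u : Mom) (θ : ℝ) (k l : ℕ) (m : ℤ) (p : Mom) : ℝ :=
  g0 u θ p * (orthoPoly θ⁻¹ l k).eval (energy u p) *
    (√(energy u p ^ 2 - 1) ^ l * sphHarm l m (yCoord u p) (phiCoord u p))

/-- The indices `(k, ℓ, m)` with `k, ℓ ∈ ℕ` and `|m| ≤ ℓ`. -/
abbrev Index : Type := {i : ℕ × ℕ × ℤ // |i.2.2| ≤ (i.2.1 : ℤ)}

/-- The indices `(k, ℓ, m)` with `|m| ≤ ℓ ≤ M` and `0 ≤ k ≤ M - ℓ`. -/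
abbrev IndexLE (M : ℕ) : Type :=
  {i : ℕ × ℕ × ℤ // |i.2.2| ≤ (i.2.1 : ℤ) ∧ i.1 + i.2.1 ≤ M}

end RelMoment

end

open RelMoment

noncomputable section

open Real MeasureTheory Set
open scoped Nat Polynomial

namespace RelMoment

/-! ## One-variable weights and their orthonormal polynomials -/

/-! Boost to the rest frame of the velocity `u`. The boosted momentum `q` has energy `E` and spatial
components `-n_i^α p_α` (`p0_boost`, `neg_mink_tetrad`), so `(y, φ)` are its polar coordinates. The
basis function becomes `g⁽⁰⁾ P_k(q⁰)` times the solid harmonic `|q|^ℓ Y_{ℓ,m}(q/|q|)`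
(`basisFun_eq`).

Orthonormality: `d³p/p⁰` is boost invariant (`integral_comp_boost`), and in the coordinates `x = q⁰,
y, φ` it is `√(x² - 1) dx dy dφ`, so the inner product factors into three one-variable integrals
(`integral_sph_coordinates`). The azimuthal integral gives `2π δ_{mm'}`; for equal `m` the Legendre
integral gives `2/(2ℓ+1) δ_{ℓℓ'}`; for equal `ℓ` the two factors `(x² - 1)^{ℓ/2}` and the measure
make the radial weight `(2ℓ+1)/(4π) ω^{(ℓ)}`, for which the `P_k` are orthonormal. The constants
multiply to one.

Spanning is a dimension count. A solid harmonic of degree `ℓ` is a polynomial of degree at most `ℓ`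
in the 4-momentum, since `|q|² = (q⁰)² - 1`, so the functions with `k + ℓ ≤ M` lie in `H_M`
(`basisFun_mem_weightedSpaceLE`). Conversely `(p⁰)² = 1 + |p|²` reduces every monomial to monomials
at most linear in `p⁰`, and those of degree at most `M` are enumerated by the same index set
(`finrank_weightedSpaceLE_le`). An orthonormal family of that cardinality therefore spans `H_M`;
every generator of `H` lies in some `H_M`. -/

lemma pow_mul_exp_neg_le (n : ℕ) {c : ℝ} (hc : 0 < c) {x : ℝ} (hx : 0 ≤ x) :
    x ^ n * exp (-c * x) ≤ (n ! : ℝ) / c ^ n := by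
  -- A single term of the exponential series suffices; all integrability below rests on this bound.
  have h := pow_div_factorial_le_exp _ (mul_nonneg hc.le hx) n
  rw [neg_mul, exp_neg, ← div_eq_mul_inv, div_le_div_iff₀ (exp_pos _) (by positivity)]
  rw [div_le_iff₀ (by positivity), mul_pow] at h
  linarith

lemma besselK_two_pos {ζ : ℝ} (hζ : 0 < ζ) : 0 < besselK 2 ζ := by
  have hint : IntegrableOn (fun t : ℝ => cosh (2 * t) * exp (-ζ * cosh t)) (Ioi 0) := by
    refine integrable_of_isBigO_exp_neg (b := 1) one_pos (by fun_prop) ?_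
    -- After multiplication by `e^t ≤ 2 cosh t`, the bound `cosh 2t ≤ (2 cosh t)²` leaves `8 cosh³ t
    -- e^{-ζ cosh t}`.
    refine Asymptotics.IsBigO.of_bound (8 * ((3 ! : ℝ) / ζ ^ 3)) ?_
    filter_upwards [Filter.eventually_ge_atTop (0 : ℝ)] with t ht
    have hc : exp t ≤ 2 * cosh t := by
      rw [cosh_eq]; linarith [exp_pos (-t)]
    have h2 : cosh (2 * t) ≤ (2 * cosh t) ^ 2 := by
      rw [cosh_two_mul]
      nlinarith [cosh_sq t, sq_nonneg (sinh t)]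
    have h3 := pow_mul_exp_neg_le 3 hζ (cosh_pos t).le
    rw [norm_of_nonneg (mul_nonneg (cosh_pos _).le (exp_pos _).le), norm_of_nonneg (exp_pos _).le,
      neg_mul 1 t, exp_neg (1 * t), one_mul, ← div_eq_mul_inv, le_div_iff₀ (exp_pos t)]
    calc cosh (2 * t) * exp (-ζ * cosh t) * exp t
        ≤ (2 * cosh t) ^ 2 * exp (-ζ * cosh t) * (2 * cosh t) := by
          gcongr
      _ = 8 * (cosh t ^ 3 * exp (-ζ * cosh t)) := by ring
      _ ≤ _ := by gcongr
  unfold besselK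
  rw [setIntegral_pos_iff_support_of_nonneg_ae _ hint]
  · have : Function.support (fun t : ℝ => cosh (2 * t) * exp (-ζ * cosh t)) = univ := by
      ext t
      simp [(cosh_pos (2 * t)).ne', exp_ne_zero]
    rw [this, univ_inter]
    simp
  · exact Filter.Eventually.of_forall fun t => mul_nonneg (cosh_pos _).le (exp_pos _).le

lemma weight_pos {ζ : ℝ} (hζ : 0 < ζ) (l : ℕ) {x : ℝ} (hx : 1 < x) : 0 < weight ζ l x := by
  have := besselK_two_pos hζ
  have : 0 < x ^ 2 - 1 := by nlinarith
  unfold weight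
  positivity

lemma rpow_half_integer {a : ℝ} (ha : 0 ≤ a) (l : ℕ) :
    a ^ ((l : ℝ) + 1 / 2) = √a ^ (2 * l + 1) := by
  rw [sqrt_eq_rpow, ← rpow_natCast, ← rpow_mul ha]
  push_cast
  ring_nf

lemma integrableOn_pow_mul_weight {ζ : ℝ} (hζ : 0 < ζ) (l n : ℕ) :
    IntegrableOn (fun x => x ^ n * weight ζ l x) (Ioi 1) := by
  have hK := besselK_two_pos hζ
  -- Half of the exponent absorbs the polynomial growth; the other half gives the decay.
  refine integrable_of_isBigO_exp_neg (b := ζ / 2) (by positivity) ?_ ?_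
  · have h : Continuous fun x : ℝ => (x ^ 2 - 1) ^ ((l : ℝ) + 1 / 2) :=
      Continuous.rpow_const (by fun_prop) fun x => Or.inr (by positivity)
    unfold weight
    exact Continuous.continuousOn (by fun_prop)
  · set N := n + (2 * l + 1)
    set A : ℝ := ζ / ((2 * l + 1) * besselK 2 ζ) with hA
    refine Asymptotics.IsBigO.of_bound (A * ((N ! : ℝ) / (ζ / 2) ^ N)) ?_
    filter_upwards [Filter.eventually_gt_atTop (1 : ℝ)] with x hx
    have hx0 : 0 < x := by linarith
    have hs : √(x ^ 2 - 1) ≤ x := by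
      rw [sqrt_le_left hx0.le]; linarith
    rw [norm_of_nonneg (mul_nonneg (by positivity) (weight_pos hζ l hx).le),
      norm_of_nonneg (exp_pos _).le]
    have h3 := pow_mul_exp_neg_le N (half_pos hζ) hx0.le
    have hA0 : 0 < A := by positivity
    calc x ^ n * weight ζ l x
        = A * (x ^ n * √(x ^ 2 - 1) ^ (2 * l + 1) * exp (-ζ * x)) := by
          rw [weight, rpow_half_integer (by nlinarith), hA]; ring
      _ ≤ A * (x ^ n * x ^ (2 * l + 1) * exp (-ζ * x)) := by gcongr
      _ = A * (x ^ N * exp (-(ζ / 2) * x)) * exp (-(ζ / 2) * x) := by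
          have he : exp (-ζ * x) = exp (-(ζ / 2) * x) * exp (-(ζ / 2) * x) := by
            rw [← exp_add]; ring_nf
          rw [he, show x ^ N = x ^ n * x ^ (2 * l + 1) from pow_add _ _ _]
          ring
      _ ≤ _ := by gcongr

lemma integrableOn_eval_mul_weight {ζ : ℝ} (hζ : 0 < ζ) (l : ℕ) (f : ℝ[X]) :
    IntegrableOn (fun x => f.eval x * weight ζ l x) (Ioi 1) := by
  simp_rw [Polynomial.eval_eq_sum_range, Finset.sum_mul, mul_assoc]
  exact integrable_finsetSum _ fun i _ => (integrableOn_pow_mul_weight hζ l i).const_mul _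

/-- `weightInner` as a bilinear form on polynomials. -/
def weightForm {ζ : ℝ} (hζ : 0 < ζ) (l : ℕ) : LinearMap.BilinForm ℝ ℝ[X] :=
  have hi (f g : ℝ[X]) : IntegrableOn (fun x => f.eval x * g.eval x * weight ζ l x) (Ioi 1) := by
    simpa using integrableOn_eval_mul_weight hζ l (f * g)
  LinearMap.mk₂ ℝ (weightInner ζ l)
    (fun f₁ f₂ g => by
      simp only [weightInner]
      rw [← integral_add (hi f₁ g) (hi f₂ g)]
      simp [add_mul])
    (fun c f g => by
      simp only [weightInner, smul_eq_mul]
      rw [← integral_const_mul]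
      simp [mul_assoc])
    (fun f g₁ g₂ => by
      simp only [weightInner]
      rw [← integral_add (hi f g₁) (hi f g₂)]
      simp [add_mul, mul_add])
    (fun c f g => by
      simp only [weightInner, smul_eq_mul]
      rw [← integral_const_mul]
      simp [mul_assoc, mul_left_comm])

@[simp] lemma weightForm_apply {ζ : ℝ} (hζ : 0 < ζ) (l : ℕ) (f g : ℝ[X]) :
    weightForm hζ l f g = weightInner ζ l f g := rfl

lemma weightInner_comm (ζ : ℝ) (l : ℕ) (f g : ℝ[X]) :
    weightInner ζ l f g = weightInner ζ l g f := by
  simp only [weightInner, mul_comm (f.eval _)]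

/-- A nonzero polynomial has finitely many roots, so the integrand is positive almost everywhere on
`(1, ∞)`. -/
lemma weightInner_self_pos {ζ : ℝ} (hζ : 0 < ζ) (l : ℕ) {f : ℝ[X]} (hf : f ≠ 0) :
    0 < weightInner ζ l f f := by
  have hi : IntegrableOn (fun x => f.eval x * f.eval x * weight ζ l x) (Ioi 1) := by
    simpa using integrableOn_eval_mul_weight hζ l (f * f)
  unfold weightInner
  rw [setIntegral_pos_iff_support_of_nonneg_ae _ hi]
  · have hsub : Ioi (1 : ℝ) \ {x | f.IsRoot x} ⊆
        Function.support (fun x => f.eval x * f.eval x * weight ζ l x) ∩ Ioi 1 := by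
      rintro x ⟨hx, hr⟩
      exact ⟨mul_ne_zero (mul_ne_zero hr hr) (weight_pos hζ l hx).ne', hx⟩
    refine lt_of_lt_of_le ?_ (measure_mono hsub)
    rw [measure_sdiff_null ((Polynomial.finite_setOfPred_isRoot hf).measure_zero _)]
    simp
  · filter_upwards [ae_restrict_mem measurableSet_Ioi] with x hx
    exact mul_nonneg (mul_self_nonneg _) (weight_pos hζ l hx).le

lemma natDegree_monicOrthoPoly_and_monic (ζ : ℝ) (l k : ℕ) :
    (monicOrthoPoly ζ l k).natDegree ≤ k ∧ (monicOrthoPoly ζ l k).Monic := by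
  induction k using Nat.strong_induction_on with
  | _ k ih =>
    rw [monicOrthoPoly]
    set S : ℝ[X] := ∑ i : Fin k,
      Polynomial.C (weightInner ζ l (Polynomial.X ^ k) (monicOrthoPoly ζ l i) /
        weightInner ζ l (monicOrthoPoly ζ l i) (monicOrthoPoly ζ l i)) * monicOrthoPoly ζ l i
    have hS : S.degree < k := by
      refine Polynomial.mem_degreeLT.1 (Submodule.sum_mem _ fun i _ => ?_)
      rw [← Polynomial.smul_eq_C_mul]
      refine Submodule.smul_mem _ _ (Polynomial.mem_degreeLT.2 ?_)
      refine (Polynomial.degree_le_of_natDegree_le (ih i i.2).1).trans_lt ?_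
      exact_mod_cast i.2
    refine ⟨?_, Polynomial.monic_X_pow_sub hS⟩
    refine Polynomial.natDegree_le_of_degree_le ?_
    refine (Polynomial.degree_sub_le _ _).trans (max_le (Polynomial.degree_X_pow_le k) hS.le)

lemma weightInner_monicOrthoPoly_of_lt {ζ : ℝ} (hζ : 0 < ζ) (l k : ℕ) :
    ∀ j < k, weightInner ζ l (monicOrthoPoly ζ l k) (monicOrthoPoly ζ l j) = 0 := by
  induction k using Nat.strong_induction_on with
  | _ k ih =>
    intro j hj
    have hpos := weightInner_self_pos hζ l (natDegree_monicOrthoPoly_and_monic ζ l j).2.ne_zero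
    rw [monicOrthoPoly, ← weightForm_apply hζ]
    simp only [map_sub, map_sum, LinearMap.sub_apply, LinearMap.sum_apply,
      ← Polynomial.smul_eq_C_mul, map_smul, LinearMap.smul_apply, smul_eq_mul, weightForm_apply]
    -- The terms with `i ≠ j` pair two polynomials of index below `k` and vanish by induction; the
    -- coefficient of the term `i = j` is chosen to cancel the first summand.
    rw [Finset.sum_eq_single (⟨j, hj⟩ : Fin k)]
    · field_simp
      simp
    · intro i _ hij
      rcases lt_or_gt_of_ne (fun h => hij (Fin.ext h) : (i : ℕ) ≠ j) with h | h
      · rw [weightInner_comm ζ l (monicOrthoPoly ζ l i) (monicOrthoPoly ζ l j), ih j hj i h, mul_zero]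
      · rw [ih i i.2 j h, mul_zero]
    · simp

lemma weightInner_orthoPoly {ζ : ℝ} (hζ : 0 < ζ) (l j k : ℕ) :
    weightInner ζ l (orthoPoly ζ l j) (orthoPoly ζ l k) = if j = k then 1 else 0 := by
  rw [← weightForm_apply hζ, orthoPoly, orthoPoly]
  simp only [← Polynomial.smul_eq_C_mul, map_smul, LinearMap.smul_apply, smul_eq_mul,
    weightForm_apply]
  split_ifs with h
  · subst h
    have hpos := weightInner_self_pos hζ l (natDegree_monicOrthoPoly_and_monic ζ l j).2.ne_zero
    have := mul_self_sqrt hpos.le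
    have := (sqrt_pos.2 hpos).ne'
    field_simp
    nlinarith
  · rcases lt_or_gt_of_ne h with h | h
    · rw [weightInner_comm ζ l (monicOrthoPoly ζ l j) (monicOrthoPoly ζ l k),
        weightInner_monicOrthoPoly_of_lt hζ l k j h]
      simp
    · rw [weightInner_monicOrthoPoly_of_lt hζ l j k h]; simp

lemma natDegree_orthoPoly_le (ζ : ℝ) (l k : ℕ) : (orthoPoly ζ l k).natDegree ≤ k :=
  (Polynomial.natDegree_C_mul_le _ _).trans (natDegree_monicOrthoPoly_and_monic ζ l k).1

/-! ## Normalisation of the associated Legendre functions -/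

/-- The `n`-th derivative of `(X² - 1)^l`. -/
def rodrigues (l n : ℕ) : ℝ[X] := Polynomial.derivative^[n] ((Polynomial.X ^ 2 - 1 : ℝ[X]) ^ l)

lemma derivative_rodrigues (l n : ℕ) :
    Polynomial.derivative (rodrigues l n) = rodrigues l (n + 1) :=
  (Function.iterate_succ_apply' _ _ _).symm

open Polynomial in
-- The function `w = (y² - 1)^l` satisfies `(y² - 1) w' = 2 l y w`. One derivative gives the case `n
-- = 0`, and each further derivative raises `n` by one.
lemma rodrigues_ode (l n : ℕ) :
    (X ^ 2 - 1) * rodrigues l (n + 2) + 2 * ((n : ℝ[X]) + 1 - (l : ℝ[X])) * X * rodrigues l (n + 1) +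
      ((n : ℝ[X]) + 1) * ((n : ℝ[X]) - 2 * (l : ℝ[X])) * rodrigues l n = 0 := by
  induction n with
  | zero =>
    have h0 : (X ^ 2 - 1) * rodrigues l 1 = 2 * (l : ℝ[X]) * X * rodrigues l 0 := by
      rw [← derivative_rodrigues]
      rcases l with _ | l
      · simp [rodrigues]
      · simp only [rodrigues, Function.iterate_zero_apply,
          derivative_pow_succ, derivative_sub, derivative_X, derivative_one, map_add, map_one,
          map_natCast]
        push_cast
        ring
    have h1 := congrArg derivative h0
    simp only [derivative_mul, derivative_rodrigues, derivative_sub, derivative_one,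
      derivative_X_sq, derivative_X, derivative_natCast, derivative_ofNat] at h1
    simp only [map_ofNat, zero_add] at h1 ⊢
    push_cast
    linear_combination h1
  | succ n ih =>
    have h1 := congrArg derivative ih
    simp only [derivative_mul, derivative_rodrigues, derivative_sub, derivative_one, derivative_add,
      derivative_X_sq, derivative_X, derivative_natCast, derivative_ofNat, derivative_zero] at h1
    simp only [map_ofNat] at h1
    push_cast
    linear_combination h1

lemma integral_eval_derivative (f : ℝ[X]) (a b : ℝ) :
    ∫ y in a..b, f.derivative.eval y = f.eval b - f.eval a :=
  intervalIntegral.integral_eq_sub_of_hasDerivAt (fun y _ => f.hasDerivAt y)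
    (f.derivative.continuous.intervalIntegrable _ _)

lemma intervalIntegrable_eval (f : ℝ[X]) (a b : ℝ) :
    IntervalIntegrable (fun y => f.eval y) volume a b :=
  f.continuous.intervalIntegrable _ _

/-- The pairing `∫_{-1}^1 (1 - y²)^m f g dy` of the derivatives of order `l + m`, `l' + m` of
`(y² - 1)^l`, `(y² - 1)^{l'}`. -/
def legendrePairing (l l' m : ℕ) : ℝ :=
  ∫ y in (-1 : ℝ)..1,
    ((1 - Polynomial.X ^ 2) ^ m * rodrigues l (l + m) * rodrigues l' (l' + m)).eval y

lemma legendrePairing_comm (l l' m : ℕ) : legendrePairing l l' m = legendrePairing l' l m := by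
  simp only [legendrePairing, mul_right_comm]

open Polynomial in
-- Integration by parts: the boundary term carries `(1 - y²)^(m+1)` and vanishes at `±1`, and the
-- differential equation at order `l + m` turns the derivative of `(1 - y²)^(m+1)` times the
-- derivative of order `l + m + 1` into a multiple of `(1 - y²)^m` times the one of order `l + m`.
lemma legendrePairing_succ (l l' m : ℕ) :
    legendrePairing l l' (m + 1) = ((l : ℝ) + m + 1) * (l - m) * legendrePairing l l' m := by
  have hode := rodrigues_ode l (l + m)
  set F : ℝ[X] := (1 - X ^ 2) ^ (m + 1) * rodrigues l (l + m + 1) * rodrigues l' (l' + m)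
  have hder : derivative F =
      (1 - X ^ 2) ^ (m + 1) * rodrigues l (l + (m + 1)) * rodrigues l' (l' + (m + 1)) -
      C (((l : ℝ) + m + 1) * (l - m)) *
        ((1 - X ^ 2) ^ m * rodrigues l (l + m) * rodrigues l' (l' + m)) := by
    simp only [F, derivative_mul, derivative_rodrigues, derivative_one,
      derivative_X, derivative_pow_succ, ← add_assoc, map_mul, map_sub, map_add, map_natCast,
      map_one]
    push_cast at hode ⊢
    linear_combination (-(1 - X ^ 2) ^ m * rodrigues l' (l' + m)) * hode
  have hint := integral_eval_derivative F (-1) 1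
  rw [hder] at hint
  simp only [eval_sub (p := _ * _ * _), eval_C_mul] at hint
  rw [intervalIntegral.integral_sub (intervalIntegrable_eval _ _ _)
    ((intervalIntegrable_eval _ _ _).const_mul _), intervalIntegral.integral_const_mul] at hint
  have hb : F.eval 1 - F.eval (-1) = 0 := by simp [F]
  rw [hb] at hint
  exact sub_eq_zero.1 hint

/-- At `m = 0` the symmetry of the pairing gives two expressions for `m = 1`, with eigenvalues
`l(l+1)` and `l'(l'+1)`; these differ, so the pairing is zero. The recursion carries this to all
`m`. -/
lemma legendrePairing_of_ne {l l' : ℕ} (h : l ≠ l') (m : ℕ) : legendrePairing l l' m = 0 := by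
  induction m with
  | zero =>
    have h1 := legendrePairing_succ l l' 0
    have h2 := legendrePairing_succ l' l 0
    rw [legendrePairing_comm l' l, legendrePairing_comm l' l, h1] at h2
    have h3 : ((l : ℝ) - l') * ((l : ℝ) + l' + 1) * legendrePairing l l' 0 = 0 := by
      push_cast at h2
      linear_combination h2
    have h4 : (l : ℝ) - l' ≠ 0 := sub_ne_zero.2 (by exact_mod_cast h)
    have h5 : (l : ℝ) + l' + 1 ≠ 0 := by positivity
    simpa [h4, h5] using h3
  | succ m ih => rw [legendrePairing_succ, ih, mul_zero]

lemma legendrePairing_self (l : ℕ) {m : ℕ} (hm : m ≤ l) :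
    legendrePairing l l m = ((l + m)! : ℝ) / ((l - m)! : ℝ) * legendrePairing l l 0 := by
  induction m with
  | zero =>
    have : ((l)! : ℝ) ≠ 0 := by positivity
    simp [this]
  | succ m ih =>
    rw [legendrePairing_succ, ih (by omega)]
    obtain ⟨d, rfl⟩ := Nat.exists_eq_add_of_le hm
    have h1 : m + 1 + d - m = d + 1 := by omega
    have h2 : m + 1 + d - (m + 1) = d := by omega
    have h3 : m + 1 + d + (m + 1) = (m + 1 + d + m) + 1 := by omega
    rw [h1, h2, h3, Nat.factorial_succ, Nat.factorial_succ]
    have : ((d)! : ℝ) ≠ 0 := by positivity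
    push_cast
    field_simp
    ring

open Polynomial in
lemma integral_one_sub_sq_pow (l : ℕ) :
    ∫ y in (-1 : ℝ)..1, ((1 - X ^ 2 : ℝ[X]) ^ l).eval y =
      2 ^ (2 * l + 1) * (l ! : ℝ) ^ 2 / ((2 * l + 1)! : ℝ) := by
  induction l with
  | zero => simp; norm_num
  | succ l ih =>
    -- This primitive vanishes at `±1`, which yields `(2l+3) I_{l+1} = 2(l+1) I_l` for the integrals
    -- `I_l` in question.
    set F : ℝ[X] := X * (1 - X ^ 2) ^ (l + 1)
    have hder : derivative F = C (2 * (l : ℝ) + 3) * (1 - X ^ 2) ^ (l + 1) -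
        C (2 * ((l : ℝ) + 1)) * (1 - X ^ 2) ^ l := by
      simp only [F, derivative_mul, derivative_sub, derivative_one, derivative_X,
        derivative_pow_succ, map_mul, map_add, map_natCast, map_one, map_ofNat]
      push_cast
      ring
    have hint := integral_eval_derivative F (-1) 1
    rw [hder] at hint
    simp only [eval_sub (p := _ * _), eval_C_mul] at hint
    rw [intervalIntegral.integral_sub ((intervalIntegrable_eval _ _ _).const_mul _)
      ((intervalIntegrable_eval _ _ _).const_mul _), intervalIntegral.integral_const_mul,
      intervalIntegral.integral_const_mul, ih] at hint
    have hb : F.eval 1 - F.eval (-1) = 0 := by simp [F]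
    rw [hb] at hint
    have h0 : (2 * (l : ℝ) + 3) ≠ 0 := by positivity
    have h1 : 2 * (l + 1) + 1 = (2 * l + 1) + 1 + 1 := by ring
    rw [← mul_right_inj' h0, sub_eq_zero.1 hint, h1, Nat.factorial_succ (2 * l + 1 + 1),
      Nat.factorial_succ (2 * l + 1), Nat.factorial_succ l]
    push_cast
    field_simp
    ring

open Polynomial in
lemma rodrigues_two_mul (l : ℕ) : rodrigues l (2 * l) = C ((2 * l)! : ℝ) := by
  have hdeg : ((X ^ 2 - 1 : ℝ[X]) ^ l).natDegree = 2 * l := by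
    rw [natDegree_pow, ← C_1, natDegree_X_pow_sub_C, mul_comm]
  have hmonic : ((X ^ 2 - 1 : ℝ[X]) ^ l).Monic := by
    rw [← C_1]
    exact (monic_X_pow_sub_C _ two_ne_zero).pow l
  have h0 : (rodrigues l (2 * l)).natDegree = 0 := by
    have := natDegree_iterate_derivative ((X ^ 2 - 1 : ℝ[X]) ^ l) (2 * l)
    rw [hdeg] at this
    unfold rodrigues
    omega
  rw [eq_C_of_natDegree_eq_zero h0, rodrigues, coeff_iterate_derivative, zero_add,
    Nat.descFactorial_self]
  have := hmonic.coeff_natDegree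
  rw [hdeg] at this
  rw [this]
  simp

open Polynomial in
-- Derivatives are moved from one factor to the other one at a time. Before step `l` the boundary
-- terms vanish because `y² - 1` still divides the derivative of order `j < l`.
lemma integral_rodrigues_mul (l j : ℕ) (hj : j ≤ l) :
    ∫ y in (-1 : ℝ)..1, (rodrigues l j * rodrigues l (2 * l - j)).eval y =
      (-1) ^ j * ∫ y in (-1 : ℝ)..1, (rodrigues l 0 * rodrigues l (2 * l)).eval y := by
  induction j with
  | zero => simp
  | succ j ih =>
    rw [pow_succ', mul_assoc, ← ih (by omega)]
    set F : ℝ[X] := rodrigues l j * rodrigues l (2 * l - (j + 1))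
    have hder : derivative F = rodrigues l (j + 1) * rodrigues l (2 * l - (j + 1)) +
        rodrigues l j * rodrigues l (2 * l - j) := by
      simp only [F, derivative_mul, derivative_rodrigues]
      rw [show 2 * l - (j + 1) + 1 = 2 * l - j by omega]
    have hint := integral_eval_derivative F (-1) 1
    rw [hder] at hint
    simp only [eval_add] at hint
    rw [intervalIntegral.integral_add (intervalIntegrable_eval _ _ _)
      (intervalIntegrable_eval _ _ _)] at hint
    have hdvd : (X ^ 2 - 1 : ℝ[X]) ∣ rodrigues l j := by
      have h := pow_sub_dvd_iterate_derivative_of_pow_dvd j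
        (dvd_refl ((X ^ 2 - 1 : ℝ[X]) ^ l))
      exact (dvd_pow_self _ (by omega)).trans h
    obtain ⟨G, hG⟩ := hdvd
    have hb : F.eval 1 - F.eval (-1) = 0 := by simp [F, hG]
    rw [hb] at hint
    linear_combination hint

open Polynomial in
-- Moving all `l` derivatives to one side leaves the constant `(2l)!` against `(1 - y²)^l`.
lemma legendrePairing_self_zero (l : ℕ) :
    legendrePairing l l 0 = (2 ^ l * (l ! : ℝ)) ^ 2 * (2 / (2 * l + 1)) := by
  have h1 := integral_rodrigues_mul l l le_rfl
  have h2 : rodrigues l 0 * rodrigues l (2 * l) =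
      C ((-1) ^ l * ((2 * l)! : ℝ)) * (1 - X ^ 2) ^ l := by
    rw [rodrigues_two_mul, rodrigues, Function.iterate_zero_apply, ← neg_sub (1 : ℝ[X]) (X ^ 2),
      neg_pow]
    simp only [map_mul, map_pow, map_neg, map_one]
    ring
  rw [h2] at h1
  simp only [eval_C_mul] at h1
  rw [intervalIntegral.integral_const_mul, integral_one_sub_sq_pow,
    show 2 * l - l = l by omega] at h1
  have h3 : legendrePairing l l 0 = ∫ y in (-1 : ℝ)..1, (rodrigues l l * rodrigues l l).eval y := by
    simp [legendrePairing]
  rw [h3, h1, Nat.factorial_succ]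
  have h4 : ((-1 : ℝ) ^ l) * (-1) ^ l = 1 := by rw [← mul_pow]; simp
  have h5 : ((2 * l)! : ℝ) ≠ 0 := by positivity
  push_cast
  field_simp
  rw [show (2 : ℝ) ^ (2 * l + 1) = 2 * (2 ^ l) ^ 2 by ring]
  linear_combination (2 * (2 ^ l) ^ 2) * h4

/-- Equal orders `m` suffice, since the azimuthal factor separates different orders. -/
lemma integral_normLegendre_mul {l l' m : ℕ} (hm : m ≤ l) (hm' : m ≤ l') :
    ∫ y in Ioo (-1 : ℝ) 1, normLegendre l m y * normLegendre l' m y =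
      if l = l' then 2 / (2 * (l : ℝ) + 1) else 0 := by
  set c : ℝ := √(((l - m)! : ℝ) / ((l + m)! : ℝ)) * √(((l' - m)! : ℝ) / ((l' + m)! : ℝ)) *
    (1 / (2 ^ l * (l ! : ℝ))) * (1 / (2 ^ l' * (l' ! : ℝ))) with hc
  have h1 : ∫ y in Ioo (-1 : ℝ) 1, normLegendre l m y * normLegendre l' m y =
      c * legendrePairing l l' m := by
    rw [legendrePairing, intervalIntegral.integral_of_le (by norm_num),
      integral_Ioc_eq_integral_Ioo, ← integral_const_mul]
    refine setIntegral_congr_fun measurableSet_Ioo fun y hy => ?_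
    have hs : √(1 - y ^ 2) ^ m * √(1 - y ^ 2) ^ m = (1 - y ^ 2) ^ m := by
      rw [← mul_pow, mul_self_sqrt (by nlinarith [hy.1, hy.2])]
    have h4 : ((-1 : ℝ) ^ m) * (-1) ^ m = 1 := by rw [← mul_pow]; simp
    simp only [normLegendre, assocLegendre, Polynomial.eval_mul, Polynomial.eval_pow,
      Polynomial.eval_sub, Polynomial.eval_one, Polynomial.eval_X, hc, ← hs, rodrigues]
    linear_combination (√(((l - m)! : ℝ) / ((l + m)! : ℝ)) *
      √(((l' - m)! : ℝ) / ((l' + m)! : ℝ)) *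
      (1 / (2 ^ l * (l ! : ℝ))) * (1 / (2 ^ l' * (l' ! : ℝ))) *
      (√(1 - y ^ 2) ^ m * √(1 - y ^ 2) ^ m *
        (Polynomial.derivative^[l + m] ((Polynomial.X ^ 2 - 1 : ℝ[X]) ^ l)).eval y *
        (Polynomial.derivative^[l' + m] ((Polynomial.X ^ 2 - 1 : ℝ[X]) ^ l')).eval y)) * h4
  rw [h1]
  split_ifs with h
  · subst h
    rw [hc, legendrePairing_self l hm, legendrePairing_self_zero, mul_self_sqrt (by positivity)]
    have h5 : ((l - m)! : ℝ) ≠ 0 := by positivity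
    field_simp
  · rw [legendrePairing_of_ne h, mul_zero]

/-! ## The azimuthal factor of the spherical harmonics -/

/-- The factor of `sphHarm l m` that depends on the azimuth. -/
def azimuthal (m : ℤ) (ph : ℝ) : ℝ :=
  if m < 0 then √2 * sin ((m.natAbs : ℝ) * ph)
  else if m = 0 then 1
  else √2 * cos ((m.natAbs : ℝ) * ph)

lemma sphHarm_eq_mul (l : ℕ) (m : ℤ) (y ph : ℝ) :
    sphHarm l m y ph = normLegendre l m.natAbs y * azimuthal m ph := by
  unfold sphHarm azimuthal
  split_ifs with h1 h2
  · ring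
  · simp [h2]
  · ring

/-- The frequency is an integer, so the azimuth in `[0, 2π)` may be exchanged for the argument in
`(-π, π]`. -/
lemma azimuthal_toIcoMod (m : ℤ) (ph : ℝ) :
    azimuthal m (toIcoMod Real.two_pi_pos 0 ph) = azimuthal m ph := by
  have h : ((m.natAbs : ℝ) * toIcoMod Real.two_pi_pos 0 ph) =
      (m.natAbs : ℝ) * ph - ((m.natAbs * toIcoDiv Real.two_pi_pos 0 ph : ℤ) : ℝ) * (2 * π) := by
    rw [← self_sub_toIcoDiv_zsmul, zsmul_eq_mul]
    push_cast [Nat.cast_natAbs]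
    ring
  rw [azimuthal, h, sin_sub_int_mul_two_pi, cos_sub_int_mul_two_pi, azimuthal]

lemma integral_cos_int_mul (n : ℤ) :
    ∫ t in (-π)..π, cos ((n : ℝ) * t) = if n = 0 then 2 * π else 0 := by
  split_ifs with h
  · subst h
    simp
    ring
  · have hn : (n : ℝ) ≠ 0 := by exact_mod_cast h
    rw [intervalIntegral.integral_comp_mul_left (fun x => cos x) hn, integral_cos]
    simp [sin_int_mul_pi]

lemma integral_sin_int_mul (n : ℤ) : ∫ t in (-π)..π, sin ((n : ℝ) * t) = 0 := by
  by_cases h : n = 0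
  · simp [h]
  · have hn : (n : ℝ) ≠ 0 := by exact_mod_cast h
    rw [intervalIntegral.integral_comp_mul_left (fun x => sin x) hn, integral_sin]
    simp

lemma integral_cos_mul_cos (a b : ℤ) :
    ∫ t in (-π)..π, cos ((a : ℝ) * t) * cos ((b : ℝ) * t) =
      ((if a - b = 0 then 2 * π else 0) + (if a + b = 0 then 2 * π else 0)) / 2 := by
  rw [← integral_cos_int_mul, ← integral_cos_int_mul, ← intervalIntegral.integral_add,
    ← intervalIntegral.integral_div]
  · congr 1 with t
    push_cast
    rw [sub_mul, add_mul, cos_sub, cos_add]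
    ring
  all_goals exact Continuous.intervalIntegrable (by fun_prop) _ _

lemma integral_sin_mul_sin (a b : ℤ) :
    ∫ t in (-π)..π, sin ((a : ℝ) * t) * sin ((b : ℝ) * t) =
      ((if a - b = 0 then 2 * π else 0) - (if a + b = 0 then 2 * π else 0)) / 2 := by
  rw [← integral_cos_int_mul, ← integral_cos_int_mul, ← intervalIntegral.integral_sub,
    ← intervalIntegral.integral_div]
  · congr 1 with t
    push_cast
    rw [sub_mul, add_mul, cos_sub, cos_add]
    ring
  all_goals exact Continuous.intervalIntegrable (by fun_prop) _ _

lemma integral_sin_mul_cos (a b : ℤ) :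
    ∫ t in (-π)..π, sin ((a : ℝ) * t) * cos ((b : ℝ) * t) = 0 := by
  have h : ∀ t, sin ((a : ℝ) * t) * cos ((b : ℝ) * t) =
      (sin (((a - b : ℤ) : ℝ) * t) + sin (((a + b : ℤ) : ℝ) * t)) / 2 := fun t => by
    push_cast
    rw [sub_mul, add_mul, sin_sub, sin_add]
    ring
  simp_rw [h]
  rw [intervalIntegral.integral_div, intervalIntegral.integral_add, integral_sin_int_mul,
    integral_sin_int_mul]
  · simp
  all_goals exact Continuous.intervalIntegrable (by fun_prop) _ _

lemma azimuthal_eq (m : ℤ) (t : ℝ) :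
    azimuthal m t = if m < 0 then -(√2 * sin ((m : ℝ) * t))
      else (if m = 0 then 1 else √2) * cos ((m : ℝ) * t) := by
  unfold azimuthal
  split_ifs with h1 h2
  · rw [Nat.cast_natAbs, abs_of_neg h1]
    simp
  · simp [h2]
  · rw [Nat.cast_natAbs, abs_of_nonneg (by omega)]

lemma integral_azimuthal_mul (m m' : ℤ) :
    ∫ t in Ioo (-π) π, azimuthal m t * azimuthal m' t = if m = m' then 2 * π else 0 := by
  rw [← integral_Ioc_eq_integral_Ioo, ← intervalIntegral.integral_of_le (by linarith [pi_pos])]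
  have h2 : √2 * √2 = 2 := mul_self_sqrt (by norm_num)
  simp_rw [azimuthal_eq]
  by_cases h : m < 0 <;> by_cases h' : m' < 0
  · simp only [h, h', if_true]
    have e : ∀ t, -(√2 * sin ((m : ℝ) * t)) * -(√2 * sin ((m' : ℝ) * t)) =
        2 * (sin ((m : ℝ) * t) * sin ((m' : ℝ) * t)) := fun t => by
      linear_combination (sin ((m : ℝ) * t) * sin ((m' : ℝ) * t)) * h2
    simp_rw [e]
    rw [intervalIntegral.integral_const_mul, integral_sin_mul_sin, if_neg (by omega : m + m' ≠ 0)]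
    simp only [sub_eq_zero]
    split_ifs <;> ring
  · simp only [h, h', if_true, if_false]
    have e : ∀ t, -(√2 * sin ((m : ℝ) * t)) * ((if m' = 0 then 1 else √2) * cos ((m' : ℝ) * t)) =
        -(√2 * (if m' = 0 then 1 else √2)) * (sin ((m : ℝ) * t) * cos ((m' : ℝ) * t)) :=
      fun t => by ring
    simp_rw [e]
    rw [intervalIntegral.integral_const_mul, integral_sin_mul_cos, if_neg (by omega : m ≠ m'), mul_zero]
  · simp only [h, h', if_true, if_false]
    have e : ∀ t, (if m = 0 then 1 else √2) * cos ((m : ℝ) * t) * -(√2 * sin ((m' : ℝ) * t)) =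
        -(√2 * (if m = 0 then 1 else √2)) * (sin ((m' : ℝ) * t) * cos ((m : ℝ) * t)) :=
      fun t => by ring
    simp_rw [e]
    rw [intervalIntegral.integral_const_mul, integral_sin_mul_cos, if_neg (by omega : m ≠ m'), mul_zero]
  · simp only [h, h', if_false]
    have e : ∀ t, (if m = 0 then 1 else √2) * cos ((m : ℝ) * t) *
        ((if m' = 0 then 1 else √2) * cos ((m' : ℝ) * t)) =
        ((if m = 0 then 1 else √2) * (if m' = 0 then 1 else √2)) *
          (cos ((m : ℝ) * t) * cos ((m' : ℝ) * t)) := fun t => by ring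
    simp_rw [e]
    rw [intervalIntegral.integral_const_mul, integral_cos_mul_cos]
    by_cases hmm : m = m'
    · subst hmm
      -- At `m = 0` both terms of `integral_cos_mul_cos` contribute, which compensates for the
      -- amplitude `1` in place of `√2`.
      by_cases h0 : m = 0
      · simp [h0]
      · rw [if_neg h0, if_neg (by omega : m + m ≠ 0), h2]
        simp
    · rw [if_neg (by omega : m - m' ≠ 0), if_neg (by omega : m + m' ≠ 0), if_neg hmm]
      simp

/-! ## Polynomials in the momentum components -/

lemma mul_span_weightedMonomial (u : Mom) (θ : ℝ) (M : ℕ) (ν : Fin 4) {f : Mom → ℝ}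
    (hf : f ∈ weightedSpaceLE u θ M) :
    (fun p => fourMom p ν) * f ∈ weightedSpaceLE u θ (M + 1) := by
  unfold weightedSpaceLE at hf
  induction hf using Submodule.span_induction with
  | mem f hf =>
    obtain ⟨n, μ, hn, rfl⟩ := hf
    refine Submodule.subset_span ⟨n + 1, Fin.cons ν μ, by omega, ?_⟩
    ext p
    simp [weightedMonomial, Fin.prod_univ_succ, mul_assoc]
  | zero => simp
  | add f g _ _ hf hg => rw [mul_add]; exact add_mem hf hg
  | smul c f _ hf => rw [mul_smul_comm]; exact Submodule.smul_mem _ _ hf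

lemma weightedSpaceLE_mono (u : Mom) (θ : ℝ) {M N : ℕ} (h : M ≤ N) :
    weightedSpaceLE u θ M ≤ weightedSpaceLE u θ N := by
  refine Submodule.span_mono ?_
  rintro f ⟨n, μ, hn, rfl⟩
  exact ⟨n, μ, hn.trans h, rfl⟩

/-- The functions `1, p⁰, p¹, p², p³` of the momentum span the affine functions of the
4-momentum. -/
def affineSpace : Submodule ℝ (Mom → ℝ) :=
  Submodule.span ℝ (insert 1 (range fun (ν : Fin 4) (p : Mom) => fourMom p ν))

lemma one_mem_affineSpace : (1 : Mom → ℝ) ∈ affineSpace :=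
  Submodule.subset_span (mem_insert _ _)

lemma fourMom_mem_affineSpace (ν : Fin 4) : (fun p : Mom => fourMom p ν) ∈ affineSpace :=
  Submodule.subset_span (mem_insert_of_mem _ ⟨ν, rfl⟩)

/-- As `1` belongs to `affineSpace`, its `M`-th power consists of the polynomials of degree at most
`M` in the 4-momentum, and degree bookkeeping becomes multiplication of submodules. -/
lemma affineSpace_pow_le {M N : ℕ} (h : M ≤ N) : affineSpace ^ M ≤ affineSpace ^ N :=
  pow_le_pow_right' (Submodule.one_le.2 one_mem_affineSpace) h

lemma mul_mem_affineSpace_pow {M N : ℕ} {f g : Mom → ℝ} (hf : f ∈ affineSpace ^ M)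
    (hg : g ∈ affineSpace ^ N) : f * g ∈ affineSpace ^ (M + N) := by
  rw [pow_add]
  exact Submodule.mul_mem_mul hf hg

lemma mul_g0_mem_weightedSpaceLE (u : Mom) (θ : ℝ) (M : ℕ) {f : Mom → ℝ}
    (hf : f ∈ affineSpace ^ M) : f * g0 u θ ∈ weightedSpaceLE u θ M := by
  induction hf using Submodule.pow_induction_on_left' with
  | algebraMap r =>
    have : g0 u θ ∈ weightedSpaceLE u θ 0 :=
      Submodule.subset_span ⟨0, Fin.elim0, le_rfl, by ext p; simp [weightedMonomial]⟩
    rw [← Algebra.smul_def]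
    exact Submodule.smul_mem _ _ this
  | add f g M _ _ hf hg => rw [add_mul]; exact add_mem hf hg
  | mem_mul m hm M f _ hf =>
    rw [mul_assoc]
    unfold affineSpace at hm
    induction hm using Submodule.span_induction with
    | mem m hm =>
      rcases hm with rfl | ⟨ν, rfl⟩
      · rw [one_mul]
        exact weightedSpaceLE_mono u θ (Nat.le_succ M) hf
      · exact mul_span_weightedMonomial u θ M ν hf
    | zero => simp
    | add a b _ _ ha hb => rw [add_mul]; exact add_mem ha hb
    | smul c a _ ha => rw [smul_mul_assoc]; exact Submodule.smul_mem _ _ ha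

/-- A monomial in the 4-momentum, of degree at most one in `p⁰`, attached to the index
`(k, ℓ, m)`; its total degree is `k + ℓ`. -/
def indexMonomial (k l : ℕ) (m : ℤ) (p : Mom) : ℝ :=
  fourMom p 3 ^ k * (if 0 ≤ m then fourMom p 1 ^ m.toNat * fourMom p 2 ^ (l - m.toNat)
    else fourMom p 0 * fourMom p 1 ^ ((-m).toNat - 1) * fourMom p 2 ^ (l - (-m).toNat))

/-- The span of the products of `g⁽⁰⁾` with the monomials `indexMonomial` of degree at most `M`. -/
def indexSpan (u : Mom) (θ : ℝ) (M : ℕ) : Submodule ℝ (Mom → ℝ) :=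
  Submodule.span ℝ (range fun (i : IndexLE M) (p : Mom) =>
    indexMonomial i.1.1 i.1.2.1 i.1.2.2 p * g0 u θ p)

lemma monomial_mem_indexSpan (u : Mom) (θ : ℝ) {M a b c : ℕ} (h : a + b + c ≤ M) :
    (fun p => fourMom p 1 ^ a * fourMom p 2 ^ b * fourMom p 3 ^ c * g0 u θ p) ∈
      indexSpan u θ M := by
  refine Submodule.subset_span ⟨⟨(c, a + b, (a : ℤ)), ?_, ?_⟩, ?_⟩
  · simp
  · simp; omega
  · ext p
    simp only [indexMonomial, if_pos (Int.natCast_nonneg a), Int.toNat_natCast,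
      Nat.add_sub_cancel_left]
    ring

/-- The sign of `m` records whether `p⁰` occurs. The value `m = 0` is used by the monomials without
`p⁰`, hence the shift to `-(a + 1)` here. -/
lemma energy_monomial_mem_indexSpan (u : Mom) (θ : ℝ) {M a b c : ℕ} (h : 1 + a + b + c ≤ M) :
    (fun p => fourMom p 0 * fourMom p 1 ^ a * fourMom p 2 ^ b * fourMom p 3 ^ c * g0 u θ p) ∈
      indexSpan u θ M := by
  refine Submodule.subset_span ⟨⟨(c, 1 + a + b, -((a : ℤ) + 1)), ?_, ?_⟩, ?_⟩
  · simp only [abs_neg]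
    rw [abs_of_nonneg (by positivity)]
    push_cast
    omega
  · simp only; omega
  · ext p
    have h1 : ¬ (0 ≤ -((a : ℤ) + 1)) := by omega
    have h2 : (- -((a : ℤ) + 1)).toNat = a + 1 := by omega
    simp only [indexMonomial, if_neg h1, h2, Nat.add_sub_cancel]
    rw [show 1 + a + b - (a + 1) = b by omega]
    ring

lemma fourMom_zero_sq (p : Mom) :
    fourMom p 0 * fourMom p 0 = 1 + fourMom p 1 ^ 2 + fourMom p 2 ^ 2 + fourMom p 3 ^ 2 := by
  have h : fourMom p 0 = √(1 + ‖p‖ ^ 2) := rfl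
  rw [h, mul_self_sqrt (by positivity), EuclideanSpace.real_norm_sq_eq, Fin.sum_univ_three]
  simp only [fourMom, show (1 : Fin 4) = Fin.succ 0 from rfl, show (2 : Fin 4) = Fin.succ 1 from rfl,
    show (3 : Fin 4) = Fin.succ 2 from rfl, Fin.cons_succ]
  ring

lemma mul_mem_indexSpan (u : Mom) (θ : ℝ) (M : ℕ) (ν : Fin 4) {f : Mom → ℝ}
    (hf : f ∈ indexSpan u θ M) : (fun p => fourMom p ν) * f ∈ indexSpan u θ (M + 1) := by
  unfold indexSpan at hf
  induction hf using Submodule.span_induction with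
  | zero => simp
  | add f g _ _ hf hg => rw [mul_add]; exact add_mem hf hg
  | smul c f _ hf => rw [mul_smul_comm]; exact Submodule.smul_mem _ _ hf
  | mem f hf =>
    obtain ⟨⟨⟨k, l, m⟩, hm, hkl⟩, rfl⟩ := hf
    simp only at hm hkl
    by_cases h0 : 0 ≤ m
    · obtain ⟨a, rfl⟩ := Int.eq_ofNat_of_zero_le h0
      have hal : a ≤ l := by rw [abs_of_nonneg h0] at hm; omega
      obtain ⟨b, rfl⟩ := Nat.exists_eq_add_of_le hal
      have e : ∀ p, indexMonomial k (a + b) (a : ℤ) p =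
          fourMom p 1 ^ a * fourMom p 2 ^ b * fourMom p 3 ^ k := fun p => by
        simp [indexMonomial]; ring
      fin_cases ν
      · convert energy_monomial_mem_indexSpan u θ (M := M + 1) (a := a) (b := b) (c := k)
          (by omega) using 1
        ext p; simp [e]; ring
      · convert monomial_mem_indexSpan u θ (M := M + 1) (a := a + 1) (b := b) (c := k)
          (by omega) using 1
        ext p; simp [e]; ring
      · convert monomial_mem_indexSpan u θ (M := M + 1) (a := a) (b := b + 1) (c := k)
          (by omega) using 1
        ext p; simp [e]; ring
      · convert monomial_mem_indexSpan u θ (M := M + 1) (a := a) (b := b) (c := k + 1)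
          (by omega) using 1
        ext p; simp [e]; ring
    · obtain ⟨a, ha⟩ : ∃ a : ℕ, (-m).toNat = a + 1 := ⟨(-m).toNat - 1, by omega⟩
      have hal : a + 1 ≤ l := by rw [abs_of_neg (by omega)] at hm; omega
      obtain ⟨b, rfl⟩ := Nat.exists_eq_add_of_le hal
      have e : ∀ p, indexMonomial k (a + 1 + b) m p =
          fourMom p 0 * fourMom p 1 ^ a * fourMom p 2 ^ b * fourMom p 3 ^ k := fun p => by
        simp only [indexMonomial, if_neg h0, ha]
        simp
        ring
      fin_cases ν
      -- Here `p⁰` occurs twice; the mass-shell relation replaces its square by four monomials, all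
      -- of degree at most `M + 1`.
      · have h1 := monomial_mem_indexSpan u θ (M := M + 1) (a := a) (b := b) (c := k) (by omega)
        have h2 := monomial_mem_indexSpan u θ (M := M + 1) (a := a + 2) (b := b) (c := k)
          (by omega)
        have h3 := monomial_mem_indexSpan u θ (M := M + 1) (a := a) (b := b + 2) (c := k)
          (by omega)
        have h4 := monomial_mem_indexSpan u θ (M := M + 1) (a := a) (b := b) (c := k + 2)
          (by omega)
        convert add_mem (add_mem (add_mem h1 h2) h3) h4 using 1
        ext p
        simp only [Pi.mul_apply, Pi.add_apply, e, Fin.zero_eta]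
        linear_combination (fourMom p 1 ^ a * fourMom p 2 ^ b * fourMom p 3 ^ k * g0 u θ p) *
          fourMom_zero_sq p
      · convert energy_monomial_mem_indexSpan u θ (M := M + 1) (a := a + 1) (b := b) (c := k)
          (by omega) using 1
        ext p; simp [e]; ring
      · convert energy_monomial_mem_indexSpan u θ (M := M + 1) (a := a) (b := b + 1) (c := k)
          (by omega) using 1
        ext p; simp [e]; ring
      · convert energy_monomial_mem_indexSpan u θ (M := M + 1) (a := a) (b := b) (c := k + 1)
          (by omega) using 1
        ext p; simp [e]; ring

lemma weightedMonomial_mem_indexSpan (u : Mom) (θ : ℝ) {M n : ℕ} (hn : n ≤ M) (μ : Fin n → Fin 4) :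
    weightedMonomial u θ μ ∈ indexSpan u θ M := by
  induction n generalizing M with
  | zero =>
    convert monomial_mem_indexSpan u θ (M := M) (a := 0) (b := 0) (c := 0) (by omega) using 1
    ext p
    simp [weightedMonomial]
  | succ n ih =>
    obtain ⟨M, rfl⟩ : ∃ N, M = N + 1 := ⟨M - 1, by omega⟩
    convert mul_mem_indexSpan u θ M (μ 0) (ih (by omega) fun j => μ j.succ) using 1
    ext p
    simp [weightedMonomial, Fin.prod_univ_succ, mul_assoc]

instance finite_indexLE (M : ℕ) : Finite (IndexLE M) := by
  refine Finite.of_injective (β := Fin (M + 1) × Fin (M + 1) × Icc (-(M : ℤ)) M)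
    (fun i => (⟨i.1.1, by have := i.2.2; omega⟩, ⟨i.1.2.1, by have := i.2.2; omega⟩,
      ⟨i.1.2.2, ?_⟩)) ?_
  · have h1 := i.2.1
    have h2 := i.2.2
    rw [abs_le] at h1
    constructor <;> omega
  · rintro ⟨⟨k, l, m⟩, h⟩ ⟨⟨k', l', m'⟩, h'⟩ heq
    simp only [Prod.mk.injEq, Fin.mk.injEq, Subtype.mk.injEq] at heq ⊢
    exact ⟨heq.1, heq.2.1, congrArg Subtype.val heq.2.2⟩

lemma weightedSpaceLE_le_indexSpan (u : Mom) (θ : ℝ) (M : ℕ) :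
    weightedSpaceLE u θ M ≤ indexSpan u θ M := by
  refine Submodule.span_le.2 ?_
  rintro f ⟨n, μ, hn, rfl⟩
  exact weightedMonomial_mem_indexSpan u θ hn μ

instance finiteDimensional_indexSpan (u : Mom) (θ : ℝ) (M : ℕ) :
    FiniteDimensional ℝ (indexSpan u θ M) :=
  FiniteDimensional.span_of_finite ℝ (finite_range _)

instance finiteDimensional_weightedSpaceLE (u : Mom) (θ : ℝ) (M : ℕ) :
    FiniteDimensional ℝ (weightedSpaceLE u θ M) :=
  Submodule.finiteDimensional_of_le (weightedSpaceLE_le_indexSpan u θ M)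

/-- Only this upper bound is needed: independence of the monomials is never used, because the
orthonormal family supplies the lower bound. -/
lemma finrank_weightedSpaceLE_le (u : Mom) (θ : ℝ) (M : ℕ) :
    Module.finrank ℝ (weightedSpaceLE u θ M) ≤ Nat.card (IndexLE M) := by
  have := Fintype.ofFinite (IndexLE M)
  refine (Submodule.finrank_mono (weightedSpaceLE_le_indexSpan u θ M)).trans ?_
  rw [Nat.card_eq_fintype_card]
  exact finrank_range_le_card _

/-! ## Lorentz boosts -/

lemma p0_pos (p : Mom) : 0 < p0 p := sqrt_pos.2 (by positivity)

lemma p0_sq (p : Mom) : p0 p ^ 2 = 1 + ‖p‖ ^ 2 := sq_sqrt (by positivity)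

lemma norm_lt_p0 (p : Mom) : ‖p‖ < p0 p := by
  have := p0_sq p
  nlinarith [p0_pos p, norm_nonneg p]

/-- The energy of `p` in the frame moving with 4-velocity `(√(1 + |w|²), w)`. -/
def boostEnergy (w p : Mom) : ℝ := p0 w * p0 p - inner ℝ w p

/-- The momentum `p` in the frame moving with 4-velocity `(√(1 + |w|²), w)`. -/
def boost (w p : Mom) : Mom := p + (inner ℝ w p / (p0 w + 1) - p0 p) • w

lemma boostEnergy_pos (w p : Mom) : 0 < boostEnergy w p := by
  have h := real_inner_le_norm w p
  have h1 := norm_lt_p0 w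
  have h2 := norm_lt_p0 p
  have h3 := mul_lt_mul'' h1 h2 (norm_nonneg _) (norm_nonneg _)
  unfold boostEnergy
  linarith

/-- The boost preserves the mass shell, so the transformed energy is the energy of the transformed
momentum. -/
lemma p0_boost (w p : Mom) : p0 (boost w p) = boostEnergy w p := by
  have hw := p0_sq w
  have hp := p0_sq p
  have hwp := p0_pos w
  rw [p0, sqrt_eq_iff_mul_self_eq (by positivity) (boostEnergy_pos w p).le, boost,
    norm_add_sq_real, norm_smul, mul_pow, inner_smul_right, real_inner_comm w p, norm_eq_abs,
    sq_abs, show ‖w‖ ^ 2 = p0 w ^ 2 - 1 by linarith, show ‖p‖ ^ 2 = p0 p ^ 2 - 1 by linarith,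
    boostEnergy]
  field_simp
  ring

lemma boost_neg_boost (w p : Mom) : boost (-w) (boost w p) = p := by
  have hw := p0_sq w
  have hwp := p0_pos w
  have hneg : p0 (-w) = p0 w := by rw [p0, p0, norm_neg]
  have h := p0_boost w p
  rw [boost, h, hneg, boostEnergy, boost, inner_neg_left, inner_add_right, inner_smul_right,
    real_inner_self_eq_norm_sq, show ‖w‖ ^ 2 = p0 w ^ 2 - 1 by linarith, smul_neg, add_assoc,
    ← sub_eq_add_neg, ← sub_smul]
  convert add_zero p
  rw [smul_eq_zero]
  left
  field_simp
  ring

lemma boost_bijective (w : Mom) : Function.Bijective (boost w) := by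
  refine Function.bijective_iff_has_inverse.2 ⟨boost (-w), boost_neg_boost w, fun p => ?_⟩
  simpa using boost_neg_boost (-w) p

/-- The derivative of `boost w` at `p`. -/
def boostDeriv (w p : Mom) : Mom →L[ℝ] Mom :=
  ContinuousLinearMap.id ℝ Mom +
    ((p0 w + 1)⁻¹ • innerSL ℝ w - (p0 p)⁻¹ • innerSL ℝ p).smulRight w

lemma hasFDerivAt_boost (w p : Mom) : HasFDerivAt (boost w) (boostDeriv w p) p := by
  have h1 : HasFDerivAt p0 ((p0 p)⁻¹ • innerSL ℝ p) p := by
    have h := ((hasStrictFDerivAt_norm_sq p).hasFDerivAt.const_add 1).sqrt (by positivity)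
    have e : (1 / (2 * √(1 + ‖p‖ ^ 2))) • 2 • innerSL ℝ p = (p0 p)⁻¹ • innerSL ℝ p := by
      ext v
      simp only [p0, smul_apply, smul_eq_mul, nsmul_eq_mul]
      push_cast
      ring
    rw [e] at h
    exact h
  have h2 : HasFDerivAt (fun q : Mom => inner ℝ w q / (p0 w + 1))
      ((p0 w + 1)⁻¹ • innerSL ℝ w) p := by
    simpa [div_eq_inv_mul] using ((innerSL ℝ w).hasFDerivAt (x := p)).const_mul (p0 w + 1)⁻¹
  exact (hasFDerivAt_id p).add ((h2.sub h1).smul_const w)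

/-- The derivative is the identity plus a rank-one map, so its determinant is one plus the value of
the functional at `w`. -/
lemma det_boostDeriv (w p : Mom) : (boostDeriv w p).det = boostEnergy w p / p0 p := by
  have hw := p0_sq w
  have hwp := p0_pos w
  have hpp := p0_pos p
  have h : ((boostDeriv w p : Mom →L[ℝ] Mom) : Mom →ₗ[ℝ] Mom) = LinearMap.transvection
      (((p0 w + 1)⁻¹ • innerSL ℝ w - (p0 p)⁻¹ • innerSL ℝ p : Mom →L[ℝ] ℝ) : Mom →ₗ[ℝ] ℝ) w := by
    ext v
    simp [boostDeriv, LinearMap.transvection]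
  rw [ContinuousLinearMap.det, h, LinearMap.transvection.det]
  simp only [ContinuousLinearMap.coe_coe, sub_apply,
    smul_apply, innerSL_apply_apply, smul_eq_mul, real_inner_self_eq_norm_sq,
    boostEnergy, real_inner_comm w p]
  rw [show ‖w‖ ^ 2 = p0 w ^ 2 - 1 by linarith]
  field_simp
  ring

/-- The measure `d³p/p⁰` is invariant under Lorentz boosts. -/
lemma integral_comp_boost (w : Mom) (F : Mom → ℝ) :
    ∫ p, F (boost w p) * (1 / p0 p) = ∫ q, F q * (1 / p0 q) := by
  have h := integral_image_eq_integral_abs_det_fderiv_smul volume (s := univ) (f := boost w)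
    MeasurableSet.univ (fun p _ => (hasFDerivAt_boost w p).hasFDerivWithinAt)
    (boost_bijective w).injective.injOn (fun q => F q * (1 / p0 q))
  rw [image_univ, (boost_bijective w).surjective.range_eq, setIntegral_univ, setIntegral_univ] at h
  rw [h]
  congr 1 with p
  have h1 := boostEnergy_pos w p
  have h2 := p0_pos p
  rw [det_boostDeriv, p0_boost, abs_of_pos (by positivity), smul_eq_mul]
  field_simp

/-- The spatial part of the 4-velocity. -/
def velocity (u : Mom) : Mom := lorentz u • u

lemma p0_velocity {u : Mom} (hu : ‖u‖ < 1) : p0 (velocity u) = lorentz u := by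
  have h : 0 < 1 - ‖u‖ ^ 2 := by nlinarith [norm_nonneg u]
  have hs := sq_sqrt h.le
  have hp := sqrt_pos.2 h
  rw [p0, sqrt_eq_iff_mul_self_eq (by positivity) (by unfold lorentz; positivity), velocity,
    norm_smul, mul_pow, norm_eq_abs, sq_abs, lorentz]
  field_simp
  linarith

lemma energy_eq_boostEnergy {u : Mom} (hu : ‖u‖ < 1) (p : Mom) :
    energy u p = boostEnergy (velocity u) p := by
  rw [boostEnergy, p0_velocity hu, energy, mink, PiLp.inner_apply]
  simp [fourVel, fourMom, velocity, mul_comm]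

/-- This identifies the tetrad directions with the coordinate axes of the rest frame. -/
lemma neg_mink_tetrad {u : Mom} (hu : ‖u‖ < 1) (p : Mom) (i : Fin 3) :
    -(mink (tetrad u i) (fourMom p)) = boost (velocity u) p i := by
  have h := (p0_pos (velocity u)).ne'
  have h1 : p0 (velocity u) + 1 ≠ 0 := by linarith [p0_pos (velocity u)]
  rw [boost, p0_velocity hu, PiLp.inner_apply] at *
  have h2 : ∑ j : Fin 3, (tetrad u i) j.succ * fourMom p j.succ =
      velocity u i * ((∑ j : Fin 3, velocity u j * p j) / (lorentz u + 1)) + p i := by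
    have h3 : ∀ j : Fin 3, (tetrad u i) j.succ * fourMom p j.succ =
        velocity u i * ((velocity u j * p j) / (lorentz u + 1)) + (if i = j then p j else 0) := by
      intro j
      simp only [tetrad, fourMom, Fin.cons_succ, fourVel, Fin.cons_zero, velocity,
        PiLp.smul_apply, smul_eq_mul]
      split_ifs <;> ring
    simp_rw [h3, Finset.sum_add_distrib, ← Finset.mul_sum, ← Finset.sum_div]
    simp
  rw [mink, h2]
  have h4 : tetrad u i 0 = velocity u i := by simp [tetrad, fourVel, velocity]
  have h5 : fourMom p 0 = p0 p := rfl
  have h6 : ∑ j : Fin 3, inner ℝ (velocity u j) (p j) = ∑ j : Fin 3, velocity u j * p j :=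
    Finset.sum_congr rfl fun j _ => by simp [mul_comm]
  rw [h4, h5, h6]
  simp
  ring

/-! ## Solid harmonics -/

/-- The polar coordinate `y` of the direction of `q`. -/
def polarY (q : Mom) : ℝ := q 2 / ‖q‖

/-- The azimuth of `q`, in `(-π, π]`. -/
def azimuth (q : Mom) : ℝ := Complex.arg ⟨q 0, q 1⟩

/-- The solid harmonic `|q|^ℓ Y_{ℓ,m}(q/|q|)`. -/
def solidHarm (l : ℕ) (m : ℤ) (q : Mom) : ℝ := ‖q‖ ^ l * sphHarm l m (polarY q) (azimuth q)

lemma sphHarm_toIcoMod (l : ℕ) (m : ℤ) (y ph : ℝ) :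
    sphHarm l m y (toIcoMod Real.two_pi_pos 0 ph) = sphHarm l m y ph := by
  rw [sphHarm_eq_mul, sphHarm_eq_mul, azimuthal_toIcoMod]

lemma arg_div_norm (q : Mom) : Complex.arg ⟨q 0 / ‖q‖, q 1 / ‖q‖⟩ = azimuth q := by
  rcases eq_or_ne q 0 with rfl | hq
  · simp [azimuth]
  · have : (⟨q 0 / ‖q‖, q 1 / ‖q‖⟩ : ℂ) = ((‖q‖⁻¹ : ℝ) : ℂ) * ⟨q 0, q 1⟩ := by
      apply Complex.ext
      · rw [Complex.re_ofReal_mul]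
        exact div_eq_inv_mul _ _
      · rw [Complex.im_ofReal_mul]
        exact div_eq_inv_mul _ _
    rw [this, Complex.arg_real_mul _ (inv_pos.2 (norm_pos_iff.2 hq)), azimuth]

lemma sqrt_energy_sq_sub_one {u : Mom} (hu : ‖u‖ < 1) (p : Mom) :
    √(energy u p ^ 2 - 1) = ‖boost (velocity u) p‖ := by
  rw [energy_eq_boostEnergy hu, ← p0_boost, p0_sq, add_sub_cancel_left, sqrt_sq (norm_nonneg _)]

lemma basisFun_eq {u : Mom} (hu : ‖u‖ < 1) (θ : ℝ) (k l : ℕ) (m : ℤ) (p : Mom) :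
    basisFun u θ k l m p = g0 u θ p *
      ((orthoPoly θ⁻¹ l k).eval (p0 (boost (velocity u) p)) *
        solidHarm l m (boost (velocity u) p)) := by
  have h : ∀ i, restDir u p i = boost (velocity u) p i / ‖boost (velocity u) p‖ := fun i => by
    rw [restDir, neg_mink_tetrad hu, sqrt_energy_sq_sub_one hu]
  rw [basisFun, phiCoord, sphHarm_toIcoMod, yCoord, h, h, h, arg_div_norm,
    sqrt_energy_sq_sub_one hu, p0_boost, ← energy_eq_boostEnergy hu, solidHarm, polarY]
  ring

lemma norm_sq_eq (q : Mom) : ‖q‖ ^ 2 = q 0 ^ 2 + q 1 ^ 2 + q 2 ^ 2 := by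
  rw [EuclideanSpace.real_norm_sq_eq, Fin.sum_univ_three]

lemma norm_mul_polarY (q : Mom) : ‖q‖ * polarY q = q 2 := by
  rcases eq_or_ne q 0 with rfl | hq
  · simp
  · rw [polarY, mul_div_cancel₀ _ (norm_ne_zero_iff.2 hq)]

lemma norm_mul_sqrt (q : Mom) : ‖q‖ * √(1 - polarY q ^ 2) = ‖(⟨q 0, q 1⟩ : ℂ)‖ := by
  nth_rewrite 1 [← sqrt_sq (norm_nonneg q)]
  rw [← sqrt_mul (by positivity), Complex.norm_def, Complex.normSq_mk]
  congr 1
  rw [mul_sub, ← mul_pow, norm_mul_polarY, norm_sq_eq]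
  ring

/-- De Moivre's formula makes the azimuthal factor, scaled by a power of the distance to the axis, a
polynomial in `q 0` and `q 1`. -/
lemma norm_pow_mul_cos_arg (z : ℂ) (n : ℕ) : ‖z‖ ^ n * cos ((n : ℝ) * z.arg) = (z ^ n).re := by
  conv_rhs => rw [← Complex.norm_mul_exp_arg_mul_I z, mul_pow, ← Complex.exp_nat_mul,
    ← Complex.ofReal_pow, Complex.re_ofReal_mul]
  rw [show (n : ℂ) * ((z.arg : ℂ) * Complex.I) = ((n * z.arg : ℝ) : ℂ) * Complex.I by
    push_cast; ring, Complex.exp_ofReal_mul_I_re]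

lemma norm_pow_mul_sin_arg (z : ℂ) (n : ℕ) : ‖z‖ ^ n * sin ((n : ℝ) * z.arg) = (z ^ n).im := by
  conv_rhs => rw [← Complex.norm_mul_exp_arg_mul_I z, mul_pow, ← Complex.exp_nat_mul,
    ← Complex.ofReal_pow, Complex.im_ofReal_mul]
  rw [show (n : ℂ) * ((z.arg : ℂ) * Complex.I) = ((n * z.arg : ℝ) : ℂ) * Complex.I by
    push_cast; ring, Complex.exp_ofReal_mul_I_im]

/-- The power `|q|^l` is shared out: `|m|` factors join `√(1 - y²)` to form the distance to the
axis, and the other `l - |m|` homogenise the polynomial in `y`. -/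
lemma solidHarm_eq {l : ℕ} {m : ℤ} (h : m.natAbs ≤ l) (q : Mom) :
    solidHarm l m q =
      (√(((l - m.natAbs)! : ℝ) / ((l + m.natAbs)! : ℝ)) * (-1) ^ m.natAbs *
        (1 / (2 ^ l * (l ! : ℝ)))) *
      ((‖q‖ ^ (l - m.natAbs) * (rodrigues l (l + m.natAbs)).eval (polarY q)) *
        (‖(⟨q 0, q 1⟩ : ℂ)‖ ^ m.natAbs * azimuthal m (azimuth q))) := by
  rw [solidHarm, sphHarm_eq_mul, normLegendre, assocLegendre, ← norm_mul_sqrt, mul_pow, rodrigues,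
    ← Nat.sub_add_cancel h, pow_add ‖q‖, Nat.sub_add_cancel h]
  ring

/-! ## The basis functions belong to the polynomial spaces -/

lemma mink_mem_affineSpace (a : Fin 4 → ℝ) : (fun p : Mom => mink a (fourMom p)) ∈ affineSpace := by
  have : (fun p : Mom => mink a (fourMom p)) = a 0 • (fun p : Mom => fourMom p 0) -
      ∑ i : Fin 3, a i.succ • (fun p : Mom => fourMom p i.succ) := by
    ext p
    simp [mink]
  rw [this]
  exact sub_mem (Submodule.smul_mem _ _ (fourMom_mem_affineSpace 0))
    (Submodule.sum_mem _ fun i _ => Submodule.smul_mem _ _ (fourMom_mem_affineSpace _))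

lemma boost_mem_affineSpace {u : Mom} (hu : ‖u‖ < 1) (i : Fin 3) :
    (fun p => boost (velocity u) p i) ∈ affineSpace := by
  simp_rw [← neg_mink_tetrad hu]
  exact neg_mem (mink_mem_affineSpace (tetrad u i))

lemma p0_boost_mem_affineSpace {u : Mom} (hu : ‖u‖ < 1) :
    (fun p => p0 (boost (velocity u) p)) ∈ affineSpace := by
  simp_rw [p0_boost, ← energy_eq_boostEnergy hu]
  exact mink_mem_affineSpace (fourVel u)

lemma norm_sq_boost_mem {u : Mom} (hu : ‖u‖ < 1) :
    (fun p => ‖boost (velocity u) p‖ ^ 2) ∈ affineSpace ^ 2 := by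
  have h : (fun p => ‖boost (velocity u) p‖ ^ 2) =
      (fun p => p0 (boost (velocity u) p)) * (fun p => p0 (boost (velocity u) p)) - 1 * 1 := by
    ext p
    simp only [Pi.sub_apply, Pi.mul_apply, Pi.one_apply]
    linear_combination -p0_sq (boost (velocity u) p)
  rw [h, pow_two]
  exact sub_mem (Submodule.mul_mem_mul (p0_boost_mem_affineSpace hu) (p0_boost_mem_affineSpace hu))
    (Submodule.mul_mem_mul one_mem_affineSpace one_mem_affineSpace)

lemma complex_pow_mem {f g : Mom → ℝ} (hf : f ∈ affineSpace) (hg : g ∈ affineSpace) (n : ℕ) :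
    (fun p => ((⟨f p, g p⟩ : ℂ) ^ n).re) ∈ affineSpace ^ n ∧
      (fun p => ((⟨f p, g p⟩ : ℂ) ^ n).im) ∈ affineSpace ^ n := by
  induction n with
  | zero =>
    have h1 : (1 : Mom → ℝ) ∈ affineSpace ^ 0 := by
      rw [pow_zero]
      exact Submodule.one_le.1 le_rfl
    constructor
    · convert h1 using 1
      ext p
      simp
    · convert Submodule.zero_mem (affineSpace ^ 0) using 1
      ext p
      simp
  | succ n ih =>
    constructor
    · have : (fun p => ((⟨f p, g p⟩ : ℂ) ^ (n + 1)).re) =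
          (fun p => ((⟨f p, g p⟩ : ℂ) ^ n).re) * f - (fun p => ((⟨f p, g p⟩ : ℂ) ^ n).im) * g := by
        ext p; simp [pow_succ]
      rw [this, pow_succ]
      exact sub_mem (Submodule.mul_mem_mul ih.1 hf) (Submodule.mul_mem_mul ih.2 hg)
    · have : (fun p => ((⟨f p, g p⟩ : ℂ) ^ (n + 1)).im) =
          (fun p => ((⟨f p, g p⟩ : ℂ) ^ n).re) * g + (fun p => ((⟨f p, g p⟩ : ℂ) ^ n).im) * f := by
        ext p; simp [pow_succ]
      rw [this, pow_succ]
      exact add_mem (Submodule.mul_mem_mul ih.1 hg) (Submodule.mul_mem_mul ih.2 hf)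

lemma azimuthal_mem {u : Mom} (hu : ‖u‖ < 1) (m : ℤ) :
    (fun p => ‖(⟨boost (velocity u) p 0, boost (velocity u) p 1⟩ : ℂ)‖ ^ m.natAbs *
      azimuthal m (azimuth (boost (velocity u) p))) ∈ affineSpace ^ m.natAbs := by
  have h := complex_pow_mem (boost_mem_affineSpace hu 0) (boost_mem_affineSpace hu 1) m.natAbs
  unfold azimuthal azimuth
  split_ifs with h1 h2
  · convert Submodule.smul_mem _ (√2) h.2 using 1
    ext p
    rw [Pi.smul_apply, ← norm_pow_mul_sin_arg, smul_eq_mul]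
    ring
  · convert h.1 using 1
    ext p
    simp [h2]
  · convert Submodule.smul_mem _ (√2) h.1 using 1
    ext p
    rw [Pi.smul_apply, ← norm_pow_mul_cos_arg, smul_eq_mul]
    ring

open Polynomial in
-- A parity statement: the exponents have the parity of `n`. After homogenisation only even powers
-- of `|q|` remain, and these are polynomials in the 4-momentum, unlike `|q|` itself.
lemma rodrigues_mem_span (l n : ℕ) :
    rodrigues l n ∈ Submodule.span ℝ {f : ℝ[X] | ∃ a b, a + 2 * b + n = 2 * l ∧ f = X ^ a} := by
  induction n with
  | zero =>
    rw [rodrigues, Function.iterate_zero_apply, sub_eq_add_neg, add_pow]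
    refine Submodule.sum_mem _ fun i hi => ?_
    have hil : i ≤ l := Nat.lt_succ_iff.1 (Finset.mem_range.1 hi)
    have : ((X ^ 2 : ℝ[X]) ^ i * (-1) ^ (l - i) * (l.choose i : ℝ[X])) =
        ((-1) ^ (l - i) * (l.choose i : ℝ)) • (X : ℝ[X]) ^ (2 * i) := by
      rw [smul_eq_C_mul, pow_mul]
      simp
      ring
    rw [this]
    exact Submodule.smul_mem _ _ (Submodule.subset_span ⟨2 * i, l - i, by omega, rfl⟩)
  | succ n ih =>
    rw [← derivative_rodrigues]
    generalize rodrigues l n = F at ih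
    induction ih using Submodule.span_induction with
    | mem f hf =>
      obtain ⟨a, b, hab, rfl⟩ := hf
      rcases a with _ | a
      · simp
      · rw [derivative_X_pow, ← smul_eq_C_mul]
        exact Submodule.smul_mem _ _ (Submodule.subset_span ⟨a, b, by omega, rfl⟩)
    | zero => simp
    | add f g _ _ hf hg => rw [derivative_add]; exact add_mem hf hg
    | smul c f _ hf => rw [derivative_smul]; exact Submodule.smul_mem _ _ hf

lemma norm_pow_mul_rodrigues_mem {u : Mom} (hu : ‖u‖ < 1) {l n : ℕ} (h : n ≤ l) :
    (fun p => ‖boost (velocity u) p‖ ^ (l - n) *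
      (rodrigues l (l + n)).eval (polarY (boost (velocity u) p))) ∈ affineSpace ^ (l - n) := by
  have key := rodrigues_mem_span l (l + n)
  generalize rodrigues l (l + n) = F at key
  induction key using Submodule.span_induction with
  | mem f hf =>
    obtain ⟨a, b, hab, rfl⟩ := hf
    have hd : l - n = a + 2 * b := by omega
    have he : (fun p => ‖boost (velocity u) p‖ ^ (l - n) *
        (Polynomial.X ^ a : ℝ[X]).eval (polarY (boost (velocity u) p))) =
        (fun p => boost (velocity u) p 2) ^ a * (fun p => ‖boost (velocity u) p‖ ^ 2) ^ b := by
      ext p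
      simp only [Pi.mul_apply, Pi.pow_apply, hd, Polynomial.eval_pow, Polynomial.eval_X]
      rw [← norm_mul_polarY, pow_add, pow_mul, mul_pow]
      ring
    rw [he, hd]
    refine mul_mem_affineSpace_pow (Submodule.pow_mem_pow _ (boost_mem_affineSpace hu 2) a) ?_
    rw [pow_mul]
    exact Submodule.pow_mem_pow _ (norm_sq_boost_mem hu) b
  | zero =>
    simp only [Polynomial.eval_zero, mul_zero]
    exact Submodule.zero_mem _
  | add f g _ _ hf hg =>
    simp only [Polynomial.eval_add, mul_add]
    exact add_mem hf hg
  | smul c f _ hf =>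
    simp only [Polynomial.eval_smul, mul_smul_comm]
    exact Submodule.smul_mem _ c hf

lemma solidHarm_boost_mem {u : Mom} (hu : ‖u‖ < 1) {l : ℕ} {m : ℤ} (h : m.natAbs ≤ l) :
    (fun p => solidHarm l m (boost (velocity u) p)) ∈ affineSpace ^ l := by
  simp_rw [solidHarm_eq h]
  have h1 := mul_mem_affineSpace_pow (norm_pow_mul_rodrigues_mem hu h) (azimuthal_mem hu m)
  rw [Nat.sub_add_cancel h] at h1
  exact Submodule.smul_mem _ _ h1

lemma eval_mem_affineSpace_pow {f : ℝ[X]} {k : ℕ} (hf : f.natDegree ≤ k) {g : Mom → ℝ}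
    (hg : g ∈ affineSpace) : (fun p => f.eval (g p)) ∈ affineSpace ^ k := by
  have : (fun p => f.eval (g p)) = ∑ i ∈ Finset.range (k + 1), f.coeff i • g ^ i := by
    ext p
    rw [Polynomial.eval_eq_sum_range' (Nat.lt_succ_of_le hf)]
    simp
  rw [this]
  refine Submodule.sum_mem _ fun i hi => Submodule.smul_mem _ _ ?_
  exact affineSpace_pow_le (Nat.lt_succ_iff.1 (Finset.mem_range.1 hi))
    (Submodule.pow_mem_pow _ hg i)

lemma natAbs_le_of_abs_le {m : ℤ} {l : ℕ} (h : |m| ≤ (l : ℤ)) : m.natAbs ≤ l := by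
  rw [Int.abs_eq_natAbs] at h
  exact_mod_cast h

lemma basisFun_mem_weightedSpaceLE {u : Mom} (hu : ‖u‖ < 1) (θ : ℝ) {k l M : ℕ} {m : ℤ}
    (hm : |m| ≤ l) (hkl : k + l ≤ M) : basisFun u θ k l m ∈ weightedSpaceLE u θ M := by
  refine weightedSpaceLE_mono u θ hkl ?_
  have h := mul_g0_mem_weightedSpaceLE u θ (k + l) (mul_mem_affineSpace_pow
    (eval_mem_affineSpace_pow (natDegree_orthoPoly_le θ⁻¹ l k) (p0_boost_mem_affineSpace hu))
    (solidHarm_boost_mem hu (natAbs_le_of_abs_le hm)))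
  convert h using 1
  ext p
  rw [basisFun_eq hu]
  simp only [Pi.mul_apply]
  ring

/-! ## Hyperbolic-spherical coordinates on momentum space -/

/-- The coordinates `(x, y, φ)`, where `x = p⁰`, `y = cos ξ` with the polar angle `ξ`, and `φ` is
the azimuth. -/
def sphMap (v : Fin 3 → ℝ) : Fin 3 → ℝ :=
  ![√(v 0 ^ 2 - 1) * √(1 - v 1 ^ 2) * cos (v 2), √(v 0 ^ 2 - 1) * √(1 - v 1 ^ 2) * sin (v 2),
    √(v 0 ^ 2 - 1) * v 1]

/-- The range of the coordinates. -/
def sphIntervals : Fin 3 → Set ℝ := ![Ioi 1, Ioo (-1) 1, Ioo (-π) π]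

/-- The domain of the coordinates. -/
def sphDomain : Set (Fin 3 → ℝ) := univ.pi sphIntervals

lemma mem_sphDomain {v : Fin 3 → ℝ} :
    v ∈ sphDomain ↔ 1 < v 0 ∧ (-1 < v 1 ∧ v 1 < 1) ∧ -π < v 2 ∧ v 2 < π := by
  simp [sphDomain, sphIntervals, Fin.forall_fin_succ]

/-- The Jacobian matrix of `sphMap`. -/
def sphJacobian (v : Fin 3 → ℝ) : Matrix (Fin 3) (Fin 3) ℝ :=
  let r := √(v 0 ^ 2 - 1)
  let s := √(1 - v 1 ^ 2)
  !![v 0 / r * s * cos (v 2), r * (-v 1 / s) * cos (v 2), -(r * s * sin (v 2));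
    v 0 / r * s * sin (v 2), r * (-v 1 / s) * sin (v 2), r * s * cos (v 2);
    v 0 / r * v 1, r, 0]

lemma hasFDerivAt_sphMap {v : Fin 3 → ℝ} (hv : v ∈ sphDomain) :
    HasFDerivAt sphMap (LinearMap.toContinuousLinearMap (Matrix.toLin' (sphJacobian v))) v := by
  rw [mem_sphDomain] at hv
  have hr : v 0 ^ 2 - 1 ≠ 0 := by nlinarith
  have hs : 1 - v 1 ^ 2 ≠ 0 := by nlinarith
  have hx (i : Fin 3) := hasFDerivAt_apply (𝕜 := ℝ) (F' := fun _ : Fin 3 => ℝ) i v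
  have d0 : HasDerivAt (fun x : ℝ => √(x ^ 2 - 1)) (v 0 / √(v 0 ^ 2 - 1)) (v 0) := by
    convert ((hasDerivAt_pow 2 (v 0)).sub_const 1).sqrt hr using 1
    norm_num
    field_simp
  have d1 : HasDerivAt (fun x : ℝ => √(1 - x ^ 2)) (-v 1 / √(1 - v 1 ^ 2)) (v 1) := by
    convert ((hasDerivAt_pow 2 (v 1)).const_sub 1).sqrt hs using 1
    norm_num
    field_simp
  have e0 := d0.comp_hasFDerivAt v (hx 0)
  have e1 := d1.comp_hasFDerivAt v (hx 1)
  have e2 := (hasDerivAt_cos (v 2)).comp_hasFDerivAt v (hx 2)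
  have e3 := (hasDerivAt_sin (v 2)).comp_hasFDerivAt v (hx 2)
  rw [hasFDerivAt_pi']
  intro i
  fin_cases i
  · refine ((e0.mul e1).mul e2).congr_fderiv (ContinuousLinearMap.ext fun w => ?_)
    simp [sphJacobian, dotProduct, Fin.sum_univ_three]
    ring
  · refine ((e0.mul e1).mul e3).congr_fderiv (ContinuousLinearMap.ext fun w => ?_)
    simp [sphJacobian, dotProduct, Fin.sum_univ_three]
    ring
  · refine (e0.mul (hx 1)).congr_fderiv (ContinuousLinearMap.ext fun w => ?_)
    simp [sphJacobian, dotProduct, Fin.sum_univ_three]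
    ring

/-- The factor `v 0` equals `p⁰` and cancels the density `1/p⁰`, leaving `√(x² - 1)`. -/
lemma det_sphJacobian {v : Fin 3 → ℝ} (hv : v ∈ sphDomain) :
    (sphJacobian v).det = -(√(v 0 ^ 2 - 1) * v 0) := by
  rw [mem_sphDomain] at hv
  have hr := (sqrt_pos.2 (by nlinarith : 0 < v 0 ^ 2 - 1)).ne'
  have hs := (sqrt_pos.2 (by nlinarith : 0 < 1 - v 1 ^ 2)).ne'
  have hs2 : √(1 - v 1 ^ 2) ^ 2 = 1 - v 1 ^ 2 := sq_sqrt (by nlinarith)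
  have ht := sin_sq_add_cos_sq (v 2)
  rw [sphJacobian, Matrix.det_fin_three]
  simp
  field_simp
  rw [hs2]
  linear_combination (-v 0) * ht

lemma norm_sphMap {v : Fin 3 → ℝ} (hv : v ∈ sphDomain) :
    ‖(WithLp.toLp 2 (sphMap v) : Mom)‖ = √(v 0 ^ 2 - 1) := by
  rw [mem_sphDomain] at hv
  have hr2 : √(v 0 ^ 2 - 1) ^ 2 = v 0 ^ 2 - 1 := sq_sqrt (by nlinarith)
  have hs2 : √(1 - v 1 ^ 2) ^ 2 = 1 - v 1 ^ 2 := sq_sqrt (by nlinarith)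
  have ht := sin_sq_add_cos_sq (v 2)
  rw [← sqrt_sq (norm_nonneg _), norm_sq_eq]
  congr 1
  simp only [sphMap, Matrix.cons_val_zero, Matrix.cons_val_one, Matrix.cons_val]
  linear_combination hr2 + √(v 0 ^ 2 - 1) ^ 2 * hs2 +
    √(v 0 ^ 2 - 1) ^ 2 * √(1 - v 1 ^ 2) ^ 2 * ht

lemma p0_sphMap {v : Fin 3 → ℝ} (hv : v ∈ sphDomain) :
    p0 (WithLp.toLp 2 (sphMap v)) = v 0 := by
  have hv' := mem_sphDomain.1 hv
  rw [p0, norm_sphMap hv, sq_sqrt (by nlinarith), add_sub_cancel, sqrt_sq (by linarith)]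

lemma polarY_sphMap {v : Fin 3 → ℝ} (hv : v ∈ sphDomain) :
    polarY (WithLp.toLp 2 (sphMap v)) = v 1 := by
  have hv' := mem_sphDomain.1 hv
  have hr := (sqrt_pos.2 (by nlinarith : 0 < v 0 ^ 2 - 1)).ne'
  rw [polarY, norm_sphMap hv]
  simp [sphMap, hr]

lemma azimuth_sphMap {v : Fin 3 → ℝ} (hv : v ∈ sphDomain) :
    azimuth (WithLp.toLp 2 (sphMap v)) = v 2 := by
  have hv' := mem_sphDomain.1 hv
  have hr := sqrt_pos.2 (by nlinarith : 0 < v 0 ^ 2 - 1)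
  have hs := sqrt_pos.2 (by nlinarith : 0 < 1 - v 1 ^ 2)
  rw [azimuth, ← Complex.arg_mul_cos_add_sin_mul_I (mul_pos hr hs) ⟨hv'.2.2.1, hv'.2.2.2.le⟩]
  congr 1
  apply Complex.ext <;> simp [sphMap, ← Complex.ofReal_cos, ← Complex.ofReal_sin, -Complex.ofReal_mul]

/-- The functions `p0`, `polarY` and `azimuth` form a left inverse. -/
lemma injOn_sphMap : InjOn sphMap sphDomain := by
  intro v hv w hw h
  have h0 := p0_sphMap hv
  have h1 := polarY_sphMap hv
  have h2 := azimuth_sphMap hv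
  rw [h] at h0 h1 h2
  ext i
  fin_cases i
  · exact h0.symm.trans (p0_sphMap hw)
  · exact h1.symm.trans (polarY_sphMap hw)
  · exact h2.symm.trans (azimuth_sphMap hw)

/-- The chart misses only the polar axis and the half-plane of azimuth `π`, both inside the null set
`q 1 = 0`. -/
lemma mem_image_sphMap {q : Fin 3 → ℝ} (hq : q 1 ≠ 0) : q ∈ sphMap '' sphDomain := by
  set Q : Mom := WithLp.toLp 2 q
  have hn : 0 < ‖Q‖ := norm_pos_iff.2 fun h => hq (by simpa [Q] using congrFun (congrArg WithLp.ofLp h) 1)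
  have hz : ‖(⟨q 0, q 1⟩ : ℂ)‖ = ‖Q‖ * √(1 - polarY Q ^ 2) := (norm_mul_sqrt Q).symm
  have hzp : (⟨q 0, q 1⟩ : ℂ) ≠ 0 := fun h => hq (congrArg Complex.im h)
  have hs : 0 < √(1 - polarY Q ^ 2) := by
    have := norm_pos_iff.2 hzp
    rw [hz] at this
    exact pos_of_mul_pos_right this hn.le
  have hs' := sqrt_pos.1 hs
  have hr : √(p0 Q ^ 2 - 1) = ‖Q‖ := by rw [p0_sq, add_sub_cancel_left, sqrt_sq hn.le]
  refine ⟨![p0 Q, polarY Q, azimuth Q], mem_sphDomain.2 ⟨?_, ?_, ?_, ?_⟩, ?_⟩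
  · have := p0_sq Q
    have := p0_pos Q
    simp only [Matrix.cons_val_zero]
    nlinarith
  · change -1 < polarY Q ∧ polarY Q < 1
    exact abs_lt.1 ((sq_lt_one_iff_abs_lt_one _).1 (by linarith))
  · exact Complex.neg_pi_lt_arg _
  · refine lt_of_le_of_ne (Complex.arg_le_pi _) fun h => ?_
    exact hq (Complex.arg_eq_pi_iff.1 h).2
  · have hc := Complex.norm_mul_cos_arg (⟨q 0, q 1⟩ : ℂ)
    have hsn := Complex.norm_mul_sin_arg (⟨q 0, q 1⟩ : ℂ)
    rw [hz] at hc hsn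
    ext i
    fin_cases i
    · simp [sphMap, hr]
      exact hc
    · simp [sphMap, hr]
      exact hsn
    · simp [sphMap, hr]
      exact norm_mul_polarY Q

/-- The integral of a product function in the coordinates `(x, y, φ)`. -/
lemma integral_sph_coordinates {F : Mom → ℝ} {a b c : ℝ → ℝ}
    (h : ∀ v ∈ sphDomain, F (WithLp.toLp 2 (sphMap v)) = a (v 0) * b (v 1) * c (v 2)) :
    ∫ q, F q * (1 / p0 q) = (∫ x in Ioi (1 : ℝ), √(x ^ 2 - 1) * a x) *
      (∫ y in Ioo (-1 : ℝ) 1, b y) * ∫ t in Ioo (-π) π, c t := by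
  have hmeas : MeasurableSet sphDomain := by
    refine MeasurableSet.univ_pi fun i => ?_
    fin_cases i
    · exact measurableSet_Ioi
    · exact measurableSet_Ioo
    · exact measurableSet_Ioo
  have hnull : (sphMap '' sphDomain : Set (Fin 3 → ℝ)) =ᵐ[volume] univ := by
    rw [ae_eq_univ]
    refine measure_mono_null (t := {q : Fin 3 → ℝ | q 1 = 0}) (fun q hq => ?_) ?_
    · by_contra h1
      exact hq (mem_image_sphMap h1)
    · exact Measure.pi_hyperplane (fun _ => volume) 1 0
  have hcv := integral_image_eq_integral_abs_det_fderiv_smul volume hmeas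
    (fun v hv => (hasFDerivAt_sphMap hv).hasFDerivWithinAt) injOn_sphMap
    (fun q => F (WithLp.toLp 2 q) * (1 / p0 (WithLp.toLp 2 q)))
  rw [setIntegral_congr_set hnull, setIntegral_univ] at hcv
  rw [← (PiLp.volume_preserving_toLp (Fin 3)).integral_comp
    (MeasurableEquiv.toLp 2 (Fin 3 → ℝ)).measurableEmbedding, hcv]
  set f : Fin 3 → ℝ → ℝ := ![fun x => √(x ^ 2 - 1) * a x, b, c]
  have hcongr : ∫ v in sphDomain,
      |(LinearMap.toContinuousLinearMap (Matrix.toLin' (sphJacobian v))).det| •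
        (F (WithLp.toLp 2 (sphMap v)) * (1 / p0 (WithLp.toLp 2 (sphMap v)))) =
      ∫ v in sphDomain, ∏ i, f i (v i) := by
    refine setIntegral_congr_fun hmeas fun v hv => ?_
    have hv0 : 0 < v 0 := by linarith [(mem_sphDomain.1 hv).1]
    simp only [LinearMap.det_toContinuousLinearMap, LinearMap.det_toLin', det_sphJacobian hv,
      abs_neg, h v hv, p0_sphMap hv, smul_eq_mul, Fin.prod_univ_three, f]
    rw [abs_of_nonneg (by positivity)]
    simp
    field_simp
  -- For a product of one-variable functions on a product domain the integral factors without any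
  -- integrability assumption.
  rw [hcongr, sphDomain, volume_pi, Measure.restrict_pi_pi, integral_fintype_prod_eq_prod,
    Fin.prod_univ_three]
  rfl

/-! ## Orthonormality -/

lemma g0_pos (u : Mom) {θ : ℝ} (hθ : 0 < θ) (p : Mom) : 0 < g0 u θ p := by
  have := besselK_two_pos (inv_pos.2 hθ)
  unfold g0
  positivity

lemma spaceInner_basisFun {u : Mom} (hu : ‖u‖ < 1) {θ : ℝ} (hθ : 0 < θ) {k l k' l' : ℕ} {m m' : ℤ}
    (hm : m.natAbs ≤ l) (hm' : m'.natAbs ≤ l') :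
    spaceInner u θ (basisFun u θ k l m) (basisFun u θ k' l' m') =
      if k = k' ∧ l = l' ∧ m = m' then 1 else 0 := by
  have hζ := inv_pos.2 hθ
  have hK := besselK_two_pos hζ
  set N : ℝ := θ⁻¹ / (4 * π * besselK 2 θ⁻¹) with hN
  set F : Mom → ℝ := fun q => N * exp (-(p0 q / θ)) *
    ((orthoPoly θ⁻¹ l k).eval (p0 q) * solidHarm l m q) *
    ((orthoPoly θ⁻¹ l' k').eval (p0 q) * solidHarm l' m' q)
  have h1 : spaceInner u θ (basisFun u θ k l m) (basisFun u θ k' l' m') =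
      ∫ p, F (boost (velocity u) p) * (1 / p0 p) := by
    rw [spaceInner]
    congr 1 with p
    have hg := (g0_pos u hθ p).ne'
    have hg' : g0 u θ p = N * exp (-(p0 (boost (velocity u) p) / θ)) := by
      rw [g0, energy_eq_boostEnergy hu, p0_boost]
    simp only [innerIntegrand, basisFun_eq hu, F, ← hg']
    field_simp
  rw [h1, integral_comp_boost, integral_sph_coordinates (F := F)
    (a := fun x => N * exp (-(x / θ)) * (orthoPoly θ⁻¹ l k).eval x * (orthoPoly θ⁻¹ l' k').eval x *
      √(x ^ 2 - 1) ^ (l + l'))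
    (b := fun y => normLegendre l m.natAbs y * normLegendre l' m'.natAbs y)
    (c := fun t => azimuthal m t * azimuthal m' t), integral_azimuthal_mul]
  -- The order matters: `m = m'` is needed for Legendre orthogonality, and `l = l'` for the radial
  -- integrand to carry the weight of index `l`.
  · by_cases hmm : m = m'
    · subst hmm
      rw [integral_normLegendre_mul hm hm']
      by_cases hll : l = l'
      · subst hll
        have h2 : ∫ x in Ioi (1 : ℝ), √(x ^ 2 - 1) * (N * exp (-(x / θ)) *
            (orthoPoly θ⁻¹ l k).eval x * (orthoPoly θ⁻¹ l k').eval x * √(x ^ 2 - 1) ^ (l + l)) =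
            (2 * l + 1) / (4 * π) *
              weightInner θ⁻¹ l (orthoPoly θ⁻¹ l k) (orthoPoly θ⁻¹ l k') := by
          rw [weightInner, ← integral_const_mul]
          refine setIntegral_congr_fun measurableSet_Ioi fun x hx => ?_
          have hx1 : (1 : ℝ) < x := hx
          simp only [weight]
          rw [rpow_half_integer (by nlinarith), hN, show -(x / θ) = -θ⁻¹ * x by ring, two_mul l,
            pow_succ √(x ^ 2 - 1)]
          have hl : (2 * (l : ℝ) + 1) ≠ 0 := by positivity
          field_simp
        rw [h2, weightInner_orthoPoly hζ]
        simp only [if_true, and_true]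
        split_ifs
        · have hl : (2 * (l : ℝ) + 1) ≠ 0 := by positivity
          field_simp
          norm_num
        · simp
      · simp [hll]
    · simp [hmm]
  · intro v hv
    simp only [F, p0_sphMap hv, solidHarm, polarY_sphMap hv, azimuth_sphMap hv, norm_sphMap hv,
      sphHarm_eq_mul]
    ring

/-! ## Integrability and the bases -/

lemma one_le_p0 (p : Mom) : 1 ≤ p0 p := by
  have := p0_sq p
  nlinarith [p0_pos p, sq_nonneg ‖p‖]

lemma abs_fourMom_le (p : Mom) (ν : Fin 4) : |fourMom p ν| ≤ p0 p := by
  refine Fin.cases ?_ (fun i => ?_) ν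
  · exact (abs_of_pos (p0_pos p)).le
  · exact (PiLp.norm_apply_le p i).trans (norm_lt_p0 p).le

lemma exists_mul_p0_le_energy {u : Mom} (hu : ‖u‖ < 1) : ∃ c > 0, ∀ p, c * p0 p ≤ energy u p := by
  -- By Cauchy–Schwarz the energy is at least `w⁰ p⁰ - |w| |p|`, with `w` the velocity part, and
  -- `|p| < p⁰`.
  refine ⟨p0 (velocity u) - ‖velocity u‖, sub_pos.2 (norm_lt_p0 _), fun p => ?_⟩
  have h := real_inner_le_norm (velocity u) p
  have h1 := mul_le_mul_of_nonneg_left (norm_lt_p0 p).le (norm_nonneg (velocity u))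
  rw [energy_eq_boostEnergy hu, boostEnergy]
  linarith

lemma continuous_p0 : Continuous p0 := by
  unfold p0
  fun_prop

lemma continuous_fourMom (ν : Fin 4) : Continuous fun p : Mom => fourMom p ν := by
  refine Fin.cases ?_ (fun i => ?_) ν
  · exact continuous_p0
  · exact (continuous_apply i).comp (PiLp.continuous_ofLp 2 _)

lemma continuous_g0 (u : Mom) (θ : ℝ) : Continuous (g0 u θ) := by
  have h : Continuous (energy u) := by
    unfold energy mink
    have := continuous_fourMom
    fun_prop
  unfold g0
  fun_prop

lemma integrable_weightedMonomial_mul {u : Mom} (hu : ‖u‖ < 1) {θ : ℝ} (hθ : 0 < θ) {n n' : ℕ}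
    (μ : Fin n → Fin 4) (ν : Fin n' → Fin 4) :
    Integrable (innerIntegrand u θ (weightedMonomial u θ μ) (weightedMonomial u θ ν)) := by
  obtain ⟨c, hc, hE⟩ := exists_mul_p0_le_energy hu
  have hK := besselK_two_pos (inv_pos.2 hθ)
  set N : ℝ := θ⁻¹ / (4 * π * besselK 2 θ⁻¹) with hN
  have hN0 : 0 < N := by positivity
  have hcθ : 0 < c / θ := by positivity
  -- The decay `(1 + |p|)^{-4}` is integrable in dimension three; the extra `4` in the exponent pays
  -- for `(1 + |p|)^4 ≤ (2 p⁰)^4`.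
  set C : ℝ := ((n + n' + 4)! : ℝ) / (c / θ) ^ (n + n' + 4)
  have hC : 0 ≤ C := by positivity
  have hdecay : Integrable fun p : Mom => (1 + ‖p‖) ^ (-(4 : ℝ)) :=
    integrable_one_add_norm (by simp; norm_num)
  have heq : innerIntegrand u θ (weightedMonomial u θ μ) (weightedMonomial u θ ν) =
      fun p => (∏ j, fourMom p (μ j)) * (∏ j, fourMom p (ν j)) * g0 u θ p * (1 / p0 p) := by
    ext p
    have := (g0_pos u hθ p).ne'
    simp only [innerIntegrand, weightedMonomial]
    field_simp
  rw [heq]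
  refine (hdecay.const_mul (N * C * 2 ^ 4)).mono' ?_ (Filter.Eventually.of_forall fun p => ?_)
  · have h1 := continuous_fourMom
    have h2 := continuous_g0 u θ
    have h3 : Continuous fun p => 1 / p0 p :=
      continuous_const.div continuous_p0 fun p => (p0_pos p).ne'
    exact Continuous.aestronglyMeasurable (by fun_prop)
  · have hp := p0_pos p
    have hp1 := one_le_p0 p
    have hprod : ∀ {k : ℕ} (κ : Fin k → Fin 4), |∏ j, fourMom p (κ j)| ≤ p0 p ^ k := fun {k} κ => by
      rw [Finset.abs_prod]
      refine (Finset.prod_le_prod (fun _ _ => abs_nonneg _) fun j _ => abs_fourMom_le p _).trans ?_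
      simp
    have hg : g0 u θ p ≤ N * exp (-(c / θ) * p0 p) := by
      unfold g0
      have : -(energy u p / θ) ≤ -(c / θ) * p0 p := by
        have := div_le_div_of_nonneg_right (hE p) hθ.le
        rw [neg_mul, neg_le_neg_iff, div_mul_eq_mul_div]
        exact this
      gcongr
    have hinv : 1 / p0 p ≤ 1 := by rw [div_le_one hp]; exact hp1
    have hpow := pow_mul_exp_neg_le (n + n' + 4) hcθ hp.le
    have hrpow : (1 + ‖p‖) ^ (-(4 : ℝ)) = ((1 + ‖p‖) ^ 4)⁻¹ := by
      rw [rpow_neg (by positivity)]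
      norm_cast
    have hle : 1 + ‖p‖ ≤ 2 * p0 p := by linarith [norm_lt_p0 p]
    rw [norm_eq_abs, abs_mul, abs_mul, abs_mul, abs_of_pos (g0_pos u hθ p),
      abs_of_pos (one_div_pos.2 hp), hrpow, ← div_eq_mul_inv, le_div_iff₀ (by positivity)]
    calc |∏ j, fourMom p (μ j)| * |∏ j, fourMom p (ν j)| * g0 u θ p * (1 / p0 p) * (1 + ‖p‖) ^ 4
        ≤ p0 p ^ n * p0 p ^ n' * (N * exp (-(c / θ) * p0 p)) * 1 * (2 * p0 p) ^ 4 := by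
          have := (g0_pos u hθ p).le
          gcongr
          · exact hprod μ
          · exact hprod ν
      _ = N * (p0 p ^ (n + n' + 4) * exp (-(c / θ) * p0 p)) * 2 ^ 4 := by ring
      _ ≤ N * C * 2 ^ 4 := by gcongr

lemma innerIntegrand_comm (u : Mom) (θ : ℝ) (f h : Mom → ℝ) :
    innerIntegrand u θ f h = innerIntegrand u θ h f := by
  ext p
  simp only [innerIntegrand]
  ring

lemma innerIntegrand_add (u : Mom) (θ : ℝ) (f g h : Mom → ℝ) :
    innerIntegrand u θ (f + g) h = innerIntegrand u θ f h + innerIntegrand u θ g h := by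
  ext p
  simp only [innerIntegrand, Pi.add_apply]
  ring

lemma innerIntegrand_smul (u : Mom) (θ : ℝ) (c : ℝ) (f h : Mom → ℝ) :
    innerIntegrand u θ (c • f) h = c • innerIntegrand u θ f h := by
  ext p
  simp only [innerIntegrand, Pi.smul_apply, smul_eq_mul]
  ring

lemma integrable_innerIntegrand_of_span {u : Mom} {θ : ℝ} {S : Set (Mom → ℝ)} {h : Mom → ℝ}
    (hS : ∀ f ∈ S, Integrable (innerIntegrand u θ f h)) :
    ∀ f ∈ Submodule.span ℝ S, Integrable (innerIntegrand u θ f h) := by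
  intro f hf
  induction hf using Submodule.span_induction with
  | mem f hf => exact hS f hf
  | zero =>
    have : innerIntegrand u θ 0 h = 0 := by ext p; simp [innerIntegrand]
    rw [this]
    exact integrable_zero _ _ _
  | add f g _ _ hf hg => rw [innerIntegrand_add]; exact hf.add hg
  | smul c f _ hf => rw [innerIntegrand_smul]; exact hf.smul c

lemma integrable_innerIntegrand {u : Mom} (hu : ‖u‖ < 1) {θ : ℝ} (hθ : 0 < θ) {f h : Mom → ℝ}
    (hf : f ∈ weightedSpace u θ) (hh : h ∈ weightedSpace u θ) :
    Integrable (innerIntegrand u θ f h) := by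
  refine integrable_innerIntegrand_of_span ?_ f hf
  rintro _ ⟨n, μ, rfl⟩
  rw [innerIntegrand_comm]
  refine integrable_innerIntegrand_of_span ?_ h hh
  rintro _ ⟨n', ν, rfl⟩
  exact integrable_weightedMonomial_mul hu hθ ν μ

/-- `spaceInner` as a bilinear form on `weightedSpace`. -/
def spaceForm {u : Mom} (hu : ‖u‖ < 1) {θ : ℝ} (hθ : 0 < θ) :
    LinearMap.BilinForm ℝ (weightedSpace u θ) :=
  LinearMap.mk₂ ℝ (fun f h => spaceInner u θ f h)
    (fun f g h => by
      simp only [spaceInner, Submodule.coe_add, innerIntegrand_add]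
      exact integral_add (integrable_innerIntegrand hu hθ f.2 h.2)
        (integrable_innerIntegrand hu hθ g.2 h.2))
    (fun c f h => by
      simp only [spaceInner, Submodule.coe_smul, innerIntegrand_smul]
      exact integral_smul c _)
    (fun f g h => by
      simp only [spaceInner, Submodule.coe_add, innerIntegrand_comm u θ f, innerIntegrand_add]
      exact integral_add (integrable_innerIntegrand hu hθ g.2 f.2)
        (integrable_innerIntegrand hu hθ h.2 f.2))
    (fun c f h => by
      simp only [spaceInner, Submodule.coe_smul, innerIntegrand_comm u θ f, innerIntegrand_smul]
      exact integral_smul c _)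

lemma weightedSpaceLE_le (u : Mom) (θ : ℝ) (M : ℕ) : weightedSpaceLE u θ M ≤ weightedSpace u θ := by
  refine Submodule.span_mono ?_
  rintro f ⟨n, μ, _, rfl⟩
  exact ⟨n, μ, rfl⟩

lemma spaceInner_basisFun_index {u : Mom} (hu : ‖u‖ < 1) {θ : ℝ} (hθ : 0 < θ) (i j : ℕ × ℕ × ℤ)
    (hi : |i.2.2| ≤ (i.2.1 : ℤ)) (hj : |j.2.2| ≤ (j.2.1 : ℤ)) :
    spaceInner u θ (basisFun u θ i.1 i.2.1 i.2.2) (basisFun u θ j.1 j.2.1 j.2.2) =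
      if i = j then 1 else 0 := by
  rw [spaceInner_basisFun hu hθ (natAbs_le_of_abs_le hi) (natAbs_le_of_abs_le hj)]
  simp only [Prod.ext_iff]

lemma linearIndependent_basisFun {u : Mom} (hu : ‖u‖ < 1) {θ : ℝ} (hθ : 0 < θ) :
    LinearIndependent ℝ fun i : Index => basisFun u θ i.1.1 i.1.2.1 i.1.2.2 := by
  have hmem (i : Index) : basisFun u θ i.1.1 i.1.2.1 i.1.2.2 ∈ weightedSpace u θ :=
    weightedSpaceLE_le u θ _ (basisFun_mem_weightedSpaceLE hu θ i.2 le_rfl)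
  have hB (i j : Index) : spaceForm hu hθ ⟨_, hmem i⟩ ⟨_, hmem j⟩ = if i.1 = j.1 then 1 else 0 :=
    spaceInner_basisFun_index hu hθ i.1 j.1 i.2 j.2
  have hLI : LinearIndependent ℝ fun i : Index =>
      (⟨basisFun u θ i.1.1 i.1.2.1 i.1.2.2, hmem i⟩ : weightedSpace u θ) := by
    refine LinearMap.BilinForm.linearIndependent_of_iIsOrtho (B := spaceForm hu hθ) ?_ ?_
    · rw [LinearMap.BilinForm.iIsOrtho_def]
      intro i j hij
      rw [hB, if_neg fun h => hij (Subtype.ext h)]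
    · intro i
      rw [hB, if_pos rfl]
      exact one_ne_zero
  exact hLI.map' (weightedSpace u θ).subtype (Submodule.ker_subtype _)

lemma linearIndependent_basisFunLE {u : Mom} (hu : ‖u‖ < 1) {θ : ℝ} (hθ : 0 < θ) (M : ℕ) :
    LinearIndependent ℝ fun i : IndexLE M => basisFun u θ i.1.1 i.1.2.1 i.1.2.2 :=
  (linearIndependent_basisFun hu hθ).comp (fun i : IndexLE M => (⟨i.1, i.2.1⟩ : Index))
    fun _ _ h => Subtype.ext (congrArg (fun k : Index => k.1) h)

/-- One inclusion and the dimension count give equality. -/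
lemma span_basisFunLE {u : Mom} (hu : ‖u‖ < 1) {θ : ℝ} (hθ : 0 < θ) (M : ℕ) :
    Submodule.span ℝ (range fun i : IndexLE M => basisFun u θ i.1.1 i.1.2.1 i.1.2.2) =
      weightedSpaceLE u θ M := by
  have := Fintype.ofFinite (IndexLE M)
  refine Submodule.eq_of_le_of_finrank_le ?_ ?_
  · refine Submodule.span_le.2 ?_
    rintro _ ⟨i, rfl⟩
    exact basisFun_mem_weightedSpaceLE hu θ i.2.1 i.2.2
  · rw [finrank_span_eq_card (linearIndependent_basisFunLE hu hθ M), ← Nat.card_eq_fintype_card]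
    exact finrank_weightedSpaceLE_le u θ M

lemma span_basisFun {u : Mom} (hu : ‖u‖ < 1) {θ : ℝ} (hθ : 0 < θ) :
    Submodule.span ℝ (range fun i : Index => basisFun u θ i.1.1 i.1.2.1 i.1.2.2) =
      weightedSpace u θ := by
  refine le_antisymm (Submodule.span_le.2 ?_) (Submodule.span_le.2 ?_)
  · rintro _ ⟨i, rfl⟩
    exact weightedSpaceLE_le u θ _ (basisFun_mem_weightedSpaceLE hu θ i.2 le_rfl)
  · rintro _ ⟨n, μ, rfl⟩
    have h : weightedMonomial u θ μ ∈ weightedSpaceLE u θ n :=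
      Submodule.subset_span ⟨n, μ, le_rfl, rfl⟩
    rw [← span_basisFunLE hu hθ] at h
    refine Submodule.span_mono ?_ h
    rintro _ ⟨i, rfl⟩
    exact ⟨⟨i.1, i.2.1⟩, rfl⟩

lemma exists_basis_of_span_eq {ι E : Type*} [AddCommGroup E] [Module ℝ E] {v : ι → E}
    (hv : LinearIndependent ℝ v) {V : Submodule ℝ E} (hV : Submodule.span ℝ (range v) = V) :
    ∃ b : Module.Basis ι ℝ V, ∀ i, (b i : E) = v i := by
  subst hV
  exact ⟨Module.Basis.span hv, fun i => congrArg Subtype.val (Module.Basis.span_apply hv i)⟩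

end RelMoment

end

open RelMoment
theorem mainTheorem3 (u : Mom) (hu : ‖u‖ < 1) (θ : ℝ) (hθ : 0 < θ) :
    (∀ f ∈ weightedSpace u θ, ∀ h ∈ weightedSpace u θ,
      MeasureTheory.Integrable (innerIntegrand u θ f h)) ∧
    (∃ b : Module.Basis Index ℝ (weightedSpace u θ),
      (∀ i : Index, (b i : Mom → ℝ) = basisFun u θ i.1.1 i.1.2.1 i.1.2.2) ∧
      ∀ i j : Index, spaceInner u θ (b i) (b j) = if i = j then 1 else 0) ∧
    ∀ M : ℕ, ∃ b : Module.Basis (IndexLE M) ℝ (weightedSpaceLE u θ M),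
      (∀ i : IndexLE M, (b i : Mom → ℝ) = basisFun u θ i.1.1 i.1.2.1 i.1.2.2) ∧
      ∀ i j : IndexLE M, spaceInner u θ (b i) (b j) = if i = j then 1 else 0 := by
  refine ⟨fun f hf h hh => integrable_innerIntegrand hu hθ hf hh, ?_, fun M => ?_⟩
  · obtain ⟨b, hb⟩ := exists_basis_of_span_eq (linearIndependent_basisFun hu hθ)
      (span_basisFun hu hθ)
    refine ⟨b, hb, fun i j => ?_⟩
    rw [hb, hb, spaceInner_basisFun_index hu hθ i.1 j.1 i.2 j.2]
    simp only [Subtype.ext_iff]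
  · obtain ⟨b, hb⟩ := exists_basis_of_span_eq (linearIndependent_basisFunLE hu hθ M)
      (span_basisFunLE hu hθ M)
    refine ⟨b, hb, fun i j => ?_⟩
    rw [hb, hb, spaceInner_basisFun_index hu hθ i.1 j.1 i.2.1 j.2.1]
    simp only [Subtype.ext_iff]
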